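/- Let $dA$ be area measure on $\mathbb{C}$ and $d\lambda(w)=\frac1\pi e^{-|w|^2}\,dA(w)$. For $0<p\le\infty$ let $F^p$ be the space of all entire functions $f$ on $\mathbb{C}$ such that $f(z)e^{-|z|^2/2}$ belongs to $L^p(\mathbb{C},dA)$, with $$\|f\|_p=\left(\frac{p}{2\pi}\int_{\mathbb{C}}\left|f(z)e^{-|z|^2/2}\right|^p\,dA(z)\right)^{1/p}\quad(0<p<\infty),\qquad \|f\|_\infty=\sup_{z\in\mathbb{C}}|f(z)|e^{-|z|^2/2}.$$ Let $s,t\in\mathbb{C}$ with $|t|<|s|$, and let $$K^{(s,t)}(z,w)=\frac1{\sqrt s}\,\exp\left[\frac{tz^2-\overline{tw^2}+2z\overline w}{2s}\right],$$ where $\sqrt{s}=\sqrt{|s|}\,e^{i\theta/2}$ for $s=|s|e^{i\theta}$, $\theta\in(-\pi,\pi]$. For every $f\in F^\infty$ the integral $$T^{(s,t)}f(z)=\int_{\mathbb{C}}K^{(s,t)}(z,w)f(w)\,d\lambda(w)$$ converges absolutely for every $z\in\mathbb{C}$, and $T^{(s,t)}f$ is an entire function. Moreover, for every $0<p\le\infty$: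 (a) $T^{(s,t)}$ is bounded on $F^p$ (that is, it maps $F^p$ linearly into $F^p$ and there is a finite constant $C$ with $\|T^{(s,t)}f\|_p\le C\|f\|_p$ for all $f\in F^p$) if and only if $|s|^2\ge|t|^2+1$; (b) $T^{(s,t)}$ is compact on $F^p$ (that is, it is bounded on $F^p$ and $\|T^{(s,t)}f_n\|_p\to0$ for every sequence $(f_n)$ in $F^p$ with $\sup_n\|f_n\|_p<\infty$ that converges to $0$ uniformly on compact subsets of $\mathbb{C}$) if and only if $|s|^2>|t|^2+1$. -/

import Mathlib

open MeasureTheory Filter Topology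
open scoped ENNReal NNReal ComplexConjugate

namespace FockSpace

/-- The weighted function `z ↦ f(z) e^{-|z|²/2}`. -/
noncomputable def weighted (f : ℂ → ℂ) (z : ℂ) : ℂ :=
  f z * (Real.exp (-‖z‖ ^ 2 / 2) : ℂ)

theorem weighted_add (f g : ℂ → ℂ) : weighted (f + g) = weighted f + weighted g := by
  funext z
  simp [weighted, add_mul]

theorem weighted_smul (c : ℂ) (f : ℂ → ℂ) : weighted (c • f) = c • weighted f := by
  funext z
  simp [weighted, mul_assoc]

theorem weighted_zero : weighted 0 = 0 := by
  funext z
  simp [weighted]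

/-- The Fock space `F^p`: entire functions `f` such that `f(z) e^{-|z|²/2}` belongs to
`L^p(ℂ, dA)`, as a linear subspace of the space of all functions `ℂ → ℂ`. -/
noncomputable def Fock (p : ℝ≥0∞) : Submodule ℂ (ℂ → ℂ) where
  carrier := {f | Differentiable ℂ f ∧ MemLp (weighted f) p (volume : Measure ℂ)}
  add_mem' := by
    rintro f g ⟨hf, hf'⟩ ⟨hg, hg'⟩
    refine ⟨hf.add hg, ?_⟩
    rw [weighted_add]
    exact hf'.add hg'
  zero_mem' := by
    refine ⟨differentiable_const (0 : ℂ), ?_⟩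
    rw [weighted_zero]
    exact MemLp.zero
  smul_mem' := by
    rintro c f ⟨hf, hf'⟩
    refine ⟨hf.const_smul c, ?_⟩
    rw [weighted_smul]
    exact hf'.const_smul c

open scoped Classical in
/-- The (quasi-)norm of `F^p`, with values in `[0, ∞]`:
`‖f‖_p^p = (p / 2π) ∫ |f(z) e^{-|z|²/2}|^p dA(z)` for `0 < p < ∞`, and
`‖f‖_∞ = sup_z |f(z)| e^{-|z|²/2}`. -/
noncomputable def fockNorm (p : ℝ≥0∞) (f : ℂ → ℂ) : ℝ≥0∞ :=
  if p = ∞ then ⨆ z : ℂ, ‖weighted f z‖ₑ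
  else (ENNReal.ofReal (p.toReal / (2 * Real.pi)) *
    ∫⁻ z : ℂ, ‖weighted f z‖ₑ ^ p.toReal) ^ (1 / p.toReal)

/-- The standard Gaussian measure `dλ(z) = (1/π) e^{-|z|²} dA(z)` on `ℂ`. -/
noncomputable def gaussian : Measure ℂ :=
  (volume : Measure ℂ).withDensity
    (fun z => ENNReal.ofReal (1 / Real.pi * Real.exp (-‖z‖ ^ 2)))

/-- The complex square root `√z = √|z| e^{iθ/2}`, where `θ ∈ (-π, π]` is the argument of `z`. -/
noncomputable def csqrt (z : ℂ) : ℂ :=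
  (Real.sqrt ‖z‖ : ℂ) * Complex.exp (Complex.I * (Complex.arg z / 2 : ℝ))

/-- The kernel `K^{(s,t)}(z,w)`. -/
noncomputable def kernel (s t z w : ℂ) : ℂ :=
  1 / csqrt s * Complex.exp ((t * z ^ 2 - conj (t * w ^ 2) + 2 * z * conj w) / (2 * s))

/-- The canonical integral operator `T^{(s,t)}`. -/
noncomputable def canonicalOp (s t : ℂ) (f : ℂ → ℂ) (z : ℂ) : ℂ :=
  ∫ w, kernel s t z w * f w ∂gaussian

/-- The linear map `L : F^p → F^p` is bounded. -/
def IsBoundedMap {p : ℝ≥0∞} (L : Fock p →ₗ[ℂ] Fock p) : Prop :=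
  ∃ C : ℝ≥0, ∀ f : Fock p, fockNorm p (L f) ≤ C * fockNorm p f

/-- The linear map `L : F^p → F^p` is compact: it is bounded and maps every bounded sequence
that converges to `0` uniformly on compact sets to a sequence converging to `0` in norm. -/
def IsCompactMap {p : ℝ≥0∞} (L : Fock p →ₗ[ℂ] Fock p) : Prop :=
  IsBoundedMap L ∧
    ∀ f : ℕ → Fock p,
      (∃ M : ℝ≥0, ∀ n, fockNorm p (f n) ≤ M) →
      (∀ D : Set ℂ, IsCompact D →
        TendstoUniformlyOn (fun n => (f n : ℂ → ℂ)) (fun _ => (0 : ℂ)) atTop D) →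
      Tendsto (fun n => fockNorm p (L (f n))) atTop (𝓝 0)

/-- The operator `T` maps `F^p` into itself, and is a bounded linear operator there. -/
def BoundedOn (p : ℝ≥0∞) (T : (ℂ → ℂ) → (ℂ → ℂ)) : Prop :=
  ∃ L : Fock p →ₗ[ℂ] Fock p, (∀ f : Fock p, (L f : ℂ → ℂ) = T f) ∧ IsBoundedMap L

/-- The operator `T` maps `F^p` into itself, and is a compact linear operator there. -/
def CompactOn (p : ℝ≥0∞) (T : (ℂ → ℂ) → (ℂ → ℂ)) : Prop :=
  ∃ L : Fock p →ₗ[ℂ] Fock p, (∀ f : Fock p, (L f : ℂ → ℂ) = T f) ∧ IsCompactMap L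

end FockSpace

/-! Write D = |s|² - |t|². Completing the square in w (`weightedKernel_eq`) shows that |K(z,w)|
e^{-|z|²/2 - |w|²/2} is |s|^{-1/2} times the exponential of -(1 - 1/D)/2 · Q₁(z) - Q₂(w - a)/2. Here
a = `peak s t z` is real-linear in z, and Q₁, Q₂ are real quadratic forms, positive definite because
|t| < |s|. The weighted kernel is thus a Gaussian ridge along w = a, and the sign of D - 1 decides
whether the ridge decays, stays level or grows.

If D > 1, the kernel is dominated by a product of Gaussians in z and in w. Point evaluations are
bounded on F^p for every p > 0, so Tf lies under a fixed Gaussian times one integral of f; this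
gives boundedness, and dominated convergence gives compactness.

If D = 1, the kernel is at most a Gaussian in w - a, and a is an invertible function of z. For p ≥ 1
Hölder's inequality and Tonelli give boundedness. For p < 1 Hölder fails, but f(w) times the
conjugate of K(z,w) is entire in w, and for entire functions the weighted L^p quasi-norm controls
the weighted L¹ norm (`exists_lintegral_rpow_le`).

Necessity is tested on the normalized reproducing kernels k_a: by the reproducing formula the
weighted modulus of T k_a at z is exactly the weighted kernel at (z,a). If D < 1 it is unbounded on
the ridge. If D = 1 it stays equal to |s|^{-1/2} there, while k_a → 0 locally uniformly as |a| → ∞,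
so compactness fails. -/

namespace FockSpace

/-! ### Mean values and point evaluations of entire functions -/

/-- Mean value property of entire functions with respect to a radial weight. -/
theorem integral_mul_radial {h : ℂ → ℂ} (hh : Differentiable ℂ h) {φ : ℝ → ℝ}
    (hφ : Measurable φ) (hi : Integrable (fun w : ℂ => h w * (φ ‖w‖ : ℂ))) :
    ∫ w : ℂ, h w * (φ ‖w‖ : ℂ) = h 0 * ∫ w : ℂ, (φ ‖w‖ : ℂ) := by
  set g : ℂ → ℂ := fun w => h w * (φ ‖w‖ : ℂ) with hg
  have hgm : Measurable g := by
    have := hh.continuous.measurable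
    fun_prop
  -- Integrate over all rotations of g and compute in two orders: area measure is rotation
  -- invariant, and for fixed w the average over θ is a mean of h over a circle centred at 0.
  set A : ℝ × ℂ → ℂ := fun x => g (Circle.exp x.1 * x.2) with hA
  have hmp : ∀ θ : ℝ, MeasurePreserving (fun w : ℂ => (Circle.exp θ : ℂ) * w) volume volume :=
    fun θ => (rotation (Circle.exp θ)).measurePreserving
  have hemb : ∀ θ : ℝ, MeasurableEmbedding (fun w : ℂ => (Circle.exp θ : ℂ) * w) :=
    fun θ => (rotation (Circle.exp θ)).toHomeomorph.measurableEmbedding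
  have hAm : Measurable A := by
    refine hgm.comp ?_
    fun_prop
  have hAi : Integrable A ((volume.restrict (Set.Ioc 0 (2 * Real.pi))).prod volume) := by
    rw [integrable_prod_iff hAm.aestronglyMeasurable]
    refine ⟨ae_of_all _ fun θ => (hmp θ).integrable_comp_of_integrable hi, ?_⟩
    have : (fun θ : ℝ => ∫ w, ‖A (θ, w)‖) = fun _ => ∫ w, ‖g w‖ := by
      funext θ
      exact (hmp θ).integral_comp (hemb θ) (fun w => ‖g w‖)
    rw [this]
    exact integrable_const _
  have h1 : ∫ θ in Set.Ioc 0 (2 * Real.pi), ∫ w, A (θ, w) = (2 * Real.pi : ℝ) • ∫ w, g w := by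
    have : (fun θ : ℝ => ∫ w, A (θ, w)) = fun _ => ∫ w, g w := by
      funext θ
      exact (hmp θ).integral_comp (hemb θ) g
    rw [this]
    simp [Real.pi_pos.le]
  have h2 : ∫ θ in Set.Ioc 0 (2 * Real.pi), ∫ w, A (θ, w)
      = ∫ w, ∫ θ in Set.Ioc 0 (2 * Real.pi), A (θ, w) := integral_integral_swap hAi
  have h3 : ∀ w : ℂ, ∫ θ in Set.Ioc 0 (2 * Real.pi), A (θ, w)
      = (2 * Real.pi : ℝ) • (h 0 * (φ ‖w‖ : ℂ)) := by
    intro w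
    have hd : DiffContOnCl ℂ (fun u : ℂ => h (u * w)) (Metric.ball 0 |1|) :=
      (hh.comp (differentiable_id.mul_const w)).diffContOnCl
    have := hd.circleAverage
    rw [Real.circleAverage_def, intervalIntegral.integral_of_le Real.two_pi_pos.le,
      inv_smul_eq_iff₀ Real.two_pi_pos.ne'] at this
    rw [zero_mul] at this
    rw [← smul_mul_assoc, ← this, ← integral_mul_const]
    simp [hA, hg, circleMap, Circle.coe_exp]
  rw [h1] at h2
  simp_rw [h3] at h2
  rw [integral_smul] at h2
  have h4 := smul_right_injective ℂ Real.two_pi_pos.ne' h2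
  rw [h4, integral_const_mul]

/-- The area sub-mean value property of entire functions. -/
theorem norm_mul_le_setIntegral_ball {h : ℂ → ℂ} (hh : Differentiable ℂ h) (z : ℂ) {δ : ℝ}
    (hδ : 0 < δ) : ‖h z‖ * (Real.pi * δ ^ 2) ≤ ∫ w in Metric.ball z δ, ‖h w‖ := by
  set φ : ℝ → ℝ := Set.indicator (Set.Iio δ) 1 with hφ
  have hφm : Measurable φ := measurable_one.indicator measurableSet_Iio
  have hd : Differentiable ℂ (fun u => h (z + u)) :=
    hh.comp ((differentiable_const z).add differentiable_id)
  have hind : ∀ k : ℂ → ℂ, (fun w : ℂ => k w * (φ ‖w‖ : ℂ)) = (Metric.ball 0 δ).indicator k := by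
    intro k
    funext w
    by_cases hw : ‖w‖ < δ <;> simp [hφ, Set.indicator, hw]
  have hint : IntegrableOn (fun u => h (z + u)) (Metric.ball 0 δ) :=
    (hd.continuous.continuousOn.integrableOn_compact
      (isCompact_closedBall 0 δ)).mono_set Metric.ball_subset_closedBall
  have h1 := integral_mul_radial hd hφm (by
    rw [hind]; exact hint.integrable_indicator Metric.isOpen_ball.measurableSet)
  have h2 : ∫ w : ℂ, (φ ‖w‖ : ℂ) = (Real.pi * δ ^ 2 : ℝ) := by
    have : (fun w : ℂ => (φ ‖w‖ : ℂ)) = (Metric.ball 0 δ).indicator (fun _ => (1 : ℂ)) := by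
      rw [← hind]; simp
    rw [this, integral_indicator Metric.isOpen_ball.measurableSet]
    simp [Measure.real, Complex.volume_ball, hδ.le]
    ring
  rw [hind, integral_indicator Metric.isOpen_ball.measurableSet, h2, add_zero] at h1
  have h3 : ∫ w in Metric.ball z δ, ‖h w‖ = ∫ u in Metric.ball 0 δ, ‖h (z + u)‖ := by
    have := (measurePreserving_add_left (volume : Measure ℂ) z).setIntegral_preimage_emb
      (measurableEmbedding_addLeft z) (fun w => ‖h w‖) (Metric.ball z δ)
    rw [← this]
    congr 2
    ext u
    simp
  rw [h3]
  calc ‖h z‖ * (Real.pi * δ ^ 2) = ‖h z * (Real.pi * δ ^ 2 : ℝ)‖ := by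
        rw [norm_mul, Complex.norm_real, Real.norm_of_nonneg (by positivity)]
    _ = ‖∫ u in Metric.ball 0 δ, h (z + u)‖ := by rw [h1]
    _ ≤ _ := norm_integral_le_integral_norm _

/-- Local point evaluation estimate for small exponents. -/
theorem norm_rpow_le_setIntegral_ball {q : ℝ} (hq : 0 < q) (hq1 : q ≤ 1) {h : ℂ → ℂ}
    (hh : Differentiable ℂ h) :
    ‖h 0‖ ^ q ≤ (4 * 4 ^ ((1 - q) / q) / Real.pi) * ∫ w in Metric.ball 0 1, ‖h w‖ ^ q := by
  set K : ℝ := 4 ^ ((1 - q) / q)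
  have hK : 0 < K := by positivity
  have hc : Continuous (fun z => ‖h z‖ ^ q) :=
    hh.continuous.norm.rpow_const fun _ => Or.inr hq.le
  have hJ : IntegrableOn (fun w => ‖h w‖ ^ q) (Metric.ball 0 1) :=
    (hc.continuousOn.integrableOn_compact
      (isCompact_closedBall 0 1)).mono_set Metric.ball_subset_closedBall
  have hJ0 : 0 ≤ ∫ w in Metric.ball 0 1, ‖h w‖ ^ q :=
    integral_nonneg fun _ => by positivity
  -- Subharmonicity of |h|^q is avoided by maximizing |h|^q (1 - |z|)². On the ball of radius (1 -
  -- |z|)/2 about the maximum point, 1 - |w| drops by at most a factor 2, so |h w|^q ≤ 4 |h z|^q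
  -- there. A maximum on the unit circle forces h 0 = 0.
  obtain ⟨z, hz, hmax⟩ := (isCompact_closedBall (0 : ℂ) 1).exists_isMaxOn
    ⟨0, by simp⟩ (hc.mul ((continuous_const.sub continuous_norm).pow 2) :
      Continuous fun z => ‖h z‖ ^ q * (1 - ‖z‖) ^ 2).continuousOn
  replace hmax : ∀ w : ℂ, ‖w‖ ≤ 1 → ‖h w‖ ^ q * (1 - ‖w‖) ^ 2 ≤ ‖h z‖ ^ q * (1 - ‖z‖) ^ 2 :=
    fun w hw => hmax (show w ∈ Metric.closedBall 0 1 by simpa using hw)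
  have h0 := hmax 0 (by simp)
  rw [norm_zero, sub_zero, one_pow, mul_one] at h0
  rw [mem_closedBall_zero_iff] at hz
  rcases eq_or_lt_of_le hz with hz1 | hz1
  · rw [hz1] at h0
    calc ‖h 0‖ ^ q ≤ 0 := by simpa using h0
      _ ≤ _ := by positivity
  rcases eq_or_lt_of_le (norm_nonneg (h z)) with ha | ha
  · rw [← ha, Real.zero_rpow hq.ne', zero_mul] at h0
    exact h0.trans (by positivity)
  set a := ‖h z‖
  set δ : ℝ := (1 - ‖z‖) / 2 with hδ
  have hδ0 : 0 < δ := by rw [hδ]; linarith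
  have hsub : Metric.ball z δ ⊆ Metric.ball 0 1 := by
    refine Metric.ball_subset_ball' ?_
    rw [dist_zero_right]
    linarith
  have hpt : ∀ w ∈ Metric.ball z δ, ‖h w‖ ≤ K * a ^ (1 - q) * ‖h w‖ ^ q := by
    intro w hw
    have hw1 : ‖w‖ ≤ 1 := (mem_ball_zero_iff.1 (hsub hw)).le
    have hw2 : δ ≤ 1 - ‖w‖ := by
      have : ‖w‖ ≤ ‖z‖ + ‖w - z‖ := by
        simpa using norm_add_le z (w - z)
      rw [mem_ball_iff_norm] at hw
      linarith
    have h4 := hmax w hw1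
    have h5 : ‖h w‖ ^ q ≤ 4 * a ^ q := by
      have : ‖h w‖ ^ q * δ ^ 2 ≤ (4 * a ^ q) * δ ^ 2 := by
        calc ‖h w‖ ^ q * δ ^ 2 ≤ ‖h w‖ ^ q * (1 - ‖w‖) ^ 2 := by gcongr
          _ ≤ a ^ q * (1 - ‖z‖) ^ 2 := h4
          _ = (4 * a ^ q) * δ ^ 2 := by rw [hδ]; ring
      exact le_of_mul_le_mul_right this (by positivity)
    have h6 : ‖h w‖ ^ (1 - q) ≤ K * a ^ (1 - q) := by
      have e : ∀ x : ℝ, 0 ≤ x → x ^ (1 - q) = (x ^ q) ^ ((1 - q) / q) := by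
        intro x hx
        rw [← Real.rpow_mul hx]
        congr 1
        field_simp
      rw [e _ (norm_nonneg _), e a ha.le, ← Real.mul_rpow (by norm_num) (by positivity)]
      exact Real.rpow_le_rpow (by positivity) h5 (div_nonneg (by linarith) hq.le)
    calc ‖h w‖ = ‖h w‖ ^ (1 - q) * ‖h w‖ ^ q := by
          rw [← Real.rpow_add_of_nonneg (norm_nonneg _) (by linarith) hq.le]; simp
      _ ≤ _ := by gcongr
  -- The L¹ mean value estimate at z, with |h| = |h|^(1-q) |h|^q; the factor a^(1-q) is then
  -- cancelled.
  have hmain : a * (Real.pi * δ ^ 2) ≤ K * a ^ (1 - q) * ∫ w in Metric.ball 0 1, ‖h w‖ ^ q := by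
    calc a * (Real.pi * δ ^ 2) ≤ ∫ w in Metric.ball z δ, ‖h w‖ :=
          norm_mul_le_setIntegral_ball hh z hδ0
      _ ≤ ∫ w in Metric.ball z δ, K * a ^ (1 - q) * ‖h w‖ ^ q := by
          refine setIntegral_mono_on ?_ ?_ Metric.isOpen_ball.measurableSet hpt
          · exact (hh.continuous.norm.continuousOn.integrableOn_compact
              (isCompact_closedBall z δ)).mono_set Metric.ball_subset_closedBall
          · exact (hJ.mono_set hsub).const_mul _
      _ = K * a ^ (1 - q) * ∫ w in Metric.ball z δ, ‖h w‖ ^ q := integral_const_mul _ _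
      _ ≤ _ := by
          exact mul_le_mul_of_nonneg_left (setIntegral_mono_set hJ
            (ae_of_all _ fun _ => by positivity) (LE.le.eventuallyLE hsub)) (by positivity)
  have haq : a = a ^ (1 - q) * a ^ q := by
    rw [← Real.rpow_add ha]; simp
  have hmain2 : a ^ q * (Real.pi * δ ^ 2) ≤ K * ∫ w in Metric.ball 0 1, ‖h w‖ ^ q := by
    have hp : 0 < a ^ (1 - q) := by positivity
    refine le_of_mul_le_mul_left ?_ hp
    calc a ^ (1 - q) * (a ^ q * (Real.pi * δ ^ 2)) = a * (Real.pi * δ ^ 2) := by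
          rw [← mul_assoc, ← haq]
      _ ≤ _ := hmain
      _ = _ := by ring
  calc ‖h 0‖ ^ q ≤ a ^ q * (1 - ‖z‖) ^ 2 := h0
    _ = 4 / Real.pi * (a ^ q * (Real.pi * δ ^ 2)) := by
        rw [hδ]; field_simp; ring
    _ ≤ 4 / Real.pi * (K * ∫ w in Metric.ball 0 1, ‖h w‖ ^ q) := by gcongr
    _ = _ := by ring

theorem sq_norm_eq (z : ℂ) : ‖z‖ ^ 2 = z.re * z.re + z.im * z.im := by
  rw [Complex.sq_norm, Complex.normSq_apply]

/-- Point evaluation at the origin is controlled by the `L^p` norm over the unit disk. -/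
theorem exists_enorm_le_eLpNorm_ball {p : ℝ≥0∞} (hp : 0 < p) :
    ∃ C : ℝ≥0, ∀ h : ℂ → ℂ, Differentiable ℂ h →
      ‖h 0‖ₑ ≤ C * eLpNorm h p (volume.restrict (Metric.ball 0 1)) := by
  have : IsFiniteMeasure (volume.restrict (Metric.ball (0 : ℂ) 1)) :=
    isFiniteMeasure_restrict.2 measure_ball_lt_top.ne
  have main : ∀ q : ℝ, 0 < q → q ≤ 1 → ∃ C : ℝ≥0, ∀ h : ℂ → ℂ, Differentiable ℂ h →
      ‖h 0‖ₑ ≤ C * eLpNorm h (ENNReal.ofReal q) (volume.restrict (Metric.ball 0 1)) := by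
    intro q hq hq1
    set K : ℝ := 4 * 4 ^ ((1 - q) / q) / Real.pi
    have hK : 0 ≤ K := by positivity
    refine ⟨(K ^ (1 / q)).toNNReal, fun h hh => ?_⟩
    have hmem : MemLp h (ENNReal.ofReal q) (volume.restrict (Metric.ball 0 1)) := by
      have : MemLp h ∞ (volume.restrict (Metric.ball 0 1)) := by
        obtain ⟨M, hM⟩ := (isCompact_closedBall (0 : ℂ) 1).exists_bound_of_continuousOn
          hh.continuous.continuousOn
        refine memLp_top_of_bound hh.continuous.aestronglyMeasurable M ?_
        filter_upwards [ae_restrict_mem Metric.isOpen_ball.measurableSet] with w hw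
        exact hM w (Metric.ball_subset_closedBall hw)
      exact this.mono_exponent le_top
    rw [hmem.eLpNorm_eq_integral_rpow_norm (by simpa using hq) ENNReal.ofReal_ne_top,
      ENNReal.toReal_ofReal hq.le, ← ofReal_norm, ENNReal.ofNNReal_toNNReal,
      ← ENNReal.ofReal_mul (by positivity), one_div]
    refine ENNReal.ofReal_le_ofReal ?_
    have h0 := norm_rpow_le_setIntegral_ball hq hq1 hh
    have hJ0 : 0 ≤ ∫ w in Metric.ball 0 1, ‖h w‖ ^ q :=
      integral_nonneg fun _ => by positivity
    rw [← Real.mul_rpow hK hJ0]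
    calc ‖h 0‖ = (‖h 0‖ ^ q) ^ q⁻¹ := (Real.rpow_rpow_inv (norm_nonneg _) hq.ne').symm
      _ ≤ _ := Real.rpow_le_rpow (by positivity) h0 (by positivity)
  -- For p ≤ 1 take q = p; for p ≥ 1 take q = 1 and use Hölder on the disk, which has finite
  -- measure.
  rcases le_total p 1 with hp1 | hp1
  · have hpt : p ≠ ∞ := (hp1.trans_lt ENNReal.one_lt_top).ne
    obtain ⟨C, hC⟩ := main p.toReal (ENNReal.toReal_pos hp.ne' hpt)
      (ENNReal.toReal_le_of_le_ofReal zero_le_one (by simpa using hp1))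
    rw [ENNReal.ofReal_toReal hpt] at hC
    exact ⟨C, hC⟩
  · obtain ⟨C, hC⟩ := main 1 one_pos le_rfl
    rw [ENNReal.ofReal_one] at hC
    have hfin : (volume.restrict (Metric.ball (0 : ℂ) 1) Set.univ)
        ^ (1 / (1 : ℝ≥0∞).toReal - 1 / p.toReal) ≠ ∞ := by
      refine ENNReal.rpow_ne_top_of_ne_zero ?_ (measure_ne_top _ _)
      rw [Measure.restrict_apply_univ]
      exact (Metric.measure_ball_pos volume (0 : ℂ) one_pos).ne'
    obtain ⟨c, hc⟩ := WithTop.ne_top_iff_exists.1 hfin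
    refine ⟨C * c, fun h hh => (hC h hh).trans ?_⟩
    rw [ENNReal.coe_mul, show (c : ℝ≥0∞) = _ from hc, mul_assoc]
    gcongr
    rw [mul_comm]
    exact eLpNorm_le_eLpNorm_mul_rpow_measure_univ hp1 hh.continuous.aestronglyMeasurable

theorem eLpNorm_comp_add_left {F : ℂ → ℂ} (hF : Continuous F) (p : ℝ≥0∞) (w : ℂ) :
    eLpNorm (fun u => F (w + u)) p volume = eLpNorm F p volume :=
  eLpNorm_comp_measurePreserving (f := fun u => w + u) hF.aestronglyMeasurable
    (measurePreserving_add_left volume w)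

/-- Point evaluations are bounded, uniformly after weighting by the Gaussian `e^{-α|w|²}`. -/
theorem exists_enorm_weight_le {p : ℝ≥0∞} (hp : 0 < p) {α : ℝ} (hα : 0 ≤ α) :
    ∃ C : ℝ≥0, ∀ h : ℂ → ℂ, Differentiable ℂ h → ∀ w : ℂ,
      ‖h w * (Real.exp (-α * ‖w‖ ^ 2) : ℂ)‖ₑ
        ≤ C * eLpNorm (fun w => h w * (Real.exp (-α * ‖w‖ ^ 2) : ℂ)) p volume := by
  obtain ⟨C, hC⟩ := exists_enorm_le_eLpNorm_ball hp
  refine ⟨C * (Real.exp α).toNNReal, fun h hh w => ?_⟩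
  set F : ℂ → ℂ := fun w => h w * (Real.exp (-α * ‖w‖ ^ 2) : ℂ) with hF
  have hFc : Continuous F := by
    have := hh.continuous
    fun_prop
  -- Translate w to 0 and multiply by a zero-free entire factor so that |k u| = e^{α|u|²} |F(w +
  -- u)|. On the unit disk the weight is at most e^α, so the estimate at the origin becomes uniform
  -- in w.
  set k : ℂ → ℂ := fun u => h (w + u) * Complex.exp (-(2 * α * conj w * u + (α * ‖w‖ ^ 2 : ℝ))) with hk
  have hkd : Differentiable ℂ k := by
    refine (hh.comp ((differentiable_const w).add differentiable_id)).mul ?_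
    fun_prop
  have hnorm : ∀ u, ‖k u‖ = Real.exp (α * ‖u‖ ^ 2) * ‖F (w + u)‖ := by
    intro u
    simp only [hk, hF, norm_mul, Complex.norm_exp, Complex.norm_real, Real.norm_eq_abs,
      Real.abs_exp]
    rw [mul_left_comm, ← Real.exp_add]
    congr 2
    simp only [sq_norm_eq, Complex.neg_re, Complex.add_re, Complex.mul_re, Complex.ofReal_re,
      Complex.ofReal_im, Complex.conj_re, Complex.conj_im, Complex.re_ofNat, Complex.im_ofNat,
      Complex.mul_im, Complex.add_im]
    ring
  have h1 : ‖F w‖ₑ ≤ ‖k 0‖ₑ := by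
    have := hnorm 0
    simp only [norm_zero, add_zero] at this
    rw [← ofReal_norm, ← ofReal_norm, this]
    simp
  refine h1.trans ((hC k hkd).trans ?_)
  rw [ENNReal.coe_mul, mul_assoc, ENNReal.ofNNReal_toNNReal]
  refine mul_le_mul_right ?_ _
  have h2 : eLpNorm k p (volume.restrict (Metric.ball 0 1))
      ≤ ENNReal.ofReal (Real.exp α) * eLpNorm (fun u => F (w + u)) p
        (volume.restrict (Metric.ball 0 1)) := by
    refine eLpNorm_le_mul_eLpNorm_of_ae_le_mul ?_ p
    filter_upwards [ae_restrict_mem Metric.isOpen_ball.measurableSet] with u hu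
    rw [mem_ball_zero_iff] at hu
    have : ‖u‖ ^ 2 ≤ 1 := pow_le_one₀ (norm_nonneg _) hu.le
    rw [hnorm]
    exact mul_le_mul_of_nonneg_right
      (Real.exp_le_exp.2 (mul_le_of_le_one_right hα this)) (norm_nonneg _)
  refine h2.trans (mul_le_mul_right ?_ _)
  calc eLpNorm (fun u => F (w + u)) p (volume.restrict (Metric.ball 0 1))
      ≤ eLpNorm (fun u => F (w + u)) p volume := eLpNorm_mono_measure _ Measure.restrict_le_self
    _ = eLpNorm F p volume :=
      eLpNorm_comp_add_left hFc p w

/-- The embedding of the weighted `L^q` space of entire functions into `L¹` for `0 < q ≤ 1`. -/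
theorem exists_lintegral_rpow_le {q : ℝ} (hq : 0 < q) (hq1 : q ≤ 1) {α : ℝ} (hα : 0 ≤ α) :
    ∃ C : ℝ≥0, ∀ h : ℂ → ℂ, Differentiable ℂ h →
      (∫⁻ w, ‖h w * (Real.exp (-α * ‖w‖ ^ 2) : ℂ)‖ₑ) ^ q
        ≤ C * ∫⁻ w, ‖h w * (Real.exp (-α * ‖w‖ ^ 2) : ℂ)‖ₑ ^ q := by
  obtain ⟨C, hC⟩ := exists_enorm_weight_le (p := ENNReal.ofReal q) (by simpa using hq) hα
  refine ⟨C ^ ((1 - q) * q), fun h hh => ?_⟩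
  set F : ℂ → ℂ := fun w => h w * (Real.exp (-α * ‖w‖ ^ 2) : ℂ) with hF
  have hFc : Continuous F := by
    have := hh.continuous
    fun_prop
  set J : ℝ≥0∞ := ∫⁻ w, ‖F w‖ₑ ^ q with hJ
  have hq' : 0 ≤ 1 - q := by linarith
  have hN : ∀ w, ‖F w‖ₑ ≤ C * J ^ (1 / q) := by
    intro w
    have := hC h hh w
    rwa [eLpNorm_eq_lintegral_rpow_enorm_toReal (by simpa using hq) ENNReal.ofReal_ne_top,
      ENNReal.toReal_ofReal hq.le] at this
  -- The factor |F|^(1-q) is bounded by the point evaluation estimate. After raising to the power q,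
  -- the exponents of J add up to 1.
  have h1 : ∫⁻ w, ‖F w‖ₑ ≤ (C * J ^ (1 / q)) ^ (1 - q) * J := by
    rw [hJ, ← lintegral_const_mul _ (by fun_prop)]
    refine lintegral_mono fun w => ?_
    calc ‖F w‖ₑ = ‖F w‖ₑ ^ (1 - q) * ‖F w‖ₑ ^ q := by
          rw [← ENNReal.rpow_add_of_nonneg _ _ hq' hq.le]; simp
      _ ≤ _ := by
          gcongr
          exact hN w
  calc (∫⁻ w, ‖F w‖ₑ) ^ q ≤ ((C * J ^ (1 / q)) ^ (1 - q) * J) ^ q := by gcongr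
    _ = _ := by
      rw [ENNReal.mul_rpow_of_nonneg _ _ hq', ENNReal.mul_rpow_of_nonneg _ _ hq.le,
        ENNReal.mul_rpow_of_nonneg _ _ hq.le, ← ENNReal.rpow_mul, ← ENNReal.rpow_mul,
        ← ENNReal.rpow_mul, mul_assoc, ← ENNReal.rpow_add_of_nonneg _ _ (by positivity) hq.le]
      have : 1 / q * ((1 - q) * q) + q = 1 := by field_simp; ring
      rw [this, ENNReal.rpow_one, ENNReal.coe_rpow_of_nonneg _ (by positivity)]

/-! ### The weighted function and the norm of F^p -/

theorem weighted_eq (f : ℂ → ℂ) :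
    weighted f = fun w => f w * (Real.exp (-(1 / 2) * ‖w‖ ^ 2) : ℂ) := by
  funext w
  rw [weighted]
  congr 3
  ring

theorem continuous_weighted {f : ℂ → ℂ} (hf : Continuous f) : Continuous (weighted f) := by
  unfold weighted
  fun_prop

/-- Point evaluations on `F^p` are bounded, uniformly after weighting. -/
theorem exists_enorm_weighted_le {p : ℝ≥0∞} (hp : 0 < p) :
    ∃ C : ℝ≥0, ∀ f : ℂ → ℂ, Differentiable ℂ f → ∀ w : ℂ,
      ‖weighted f w‖ₑ ≤ C * eLpNorm (weighted f) p volume := by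
  obtain ⟨C, hC⟩ := exists_enorm_weight_le hp (show (0 : ℝ) ≤ 1 / 2 by norm_num)
  refine ⟨C, fun f hf w => ?_⟩
  rw [weighted_eq]
  exact hC f hf w

/-- For a continuous function the essential supremum is a true supremum, because nonempty open sets
have positive area. -/
theorem enorm_le_eLpNorm_top {F : ℂ → ℂ} (hF : Continuous F) (w : ℂ) :
    ‖F w‖ₑ ≤ eLpNorm F ∞ volume := by
  by_contra! hlt
  have hop : IsOpen {w | eLpNorm F ∞ volume < ‖F w‖ₑ} :=
    isOpen_lt continuous_const hF.enorm
  have h0 : volume {w | eLpNorm F ∞ volume < ‖F w‖ₑ} = 0 := by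
    have := ae_le_eLpNormEssSup (f := F) (μ := (volume : Measure ℂ))
    rw [← eLpNorm_exponent_top, ae_iff] at this
    simpa using this
  exact (hop.measure_pos volume ⟨w, hlt⟩).ne' h0

/-- The norm of `F^p` is a positive multiple of the `L^p` norm of the weighted function. -/
theorem exists_fockNorm_eq {p : ℝ≥0∞} (hp : 0 < p) :
    ∃ c : ℝ≥0, c ≠ 0 ∧ ∀ f : ℂ → ℂ, Continuous f →
      fockNorm p f = c * eLpNorm (weighted f) p volume := by
  by_cases hpt : p = ∞
  · subst hpt
    refine ⟨1, one_ne_zero, fun f hf => ?_⟩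
    rw [ENNReal.coe_one, one_mul, fockNorm, if_pos rfl]
    refine le_antisymm (iSup_le fun w => enorm_le_eLpNorm_top (continuous_weighted hf) w) ?_
    rw [eLpNorm_exponent_top]
    exact essSup_le_of_ae_le _ (ae_of_all _ fun w => le_iSup (fun z => ‖weighted f z‖ₑ) w)
  · have hq : 0 < p.toReal := ENNReal.toReal_pos hp.ne' hpt
    refine ⟨((p.toReal / (2 * Real.pi)).toNNReal) ^ (1 / p.toReal), ?_, fun f _ => ?_⟩
    · exact (NNReal.rpow_pos (Real.toNNReal_pos.2 (by positivity))).ne'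
    · rw [fockNorm, if_neg hpt, ENNReal.mul_rpow_of_nonneg _ _ (by positivity),
        eLpNorm_eq_lintegral_rpow_enorm_toReal hp.ne' hpt,
        ENNReal.coe_rpow_of_nonneg _ (by positivity), ENNReal.ofNNReal_toNNReal]

/-! ### The size of the weighted kernel -/

theorem norm_csqrt (s : ℂ) : ‖csqrt s‖ = Real.sqrt ‖s‖ := by
  rw [csqrt, norm_mul, mul_comm Complex.I, Complex.norm_exp_ofReal_mul_I, mul_one,
    Complex.norm_real, Real.norm_of_nonneg (Real.sqrt_nonneg _)]

theorem norm_kernel (s t z w : ℂ) :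
    ‖kernel s t z w‖ = (Real.sqrt ‖s‖)⁻¹ *
      Real.exp ((t * z ^ 2 - conj (t * w ^ 2) + 2 * z * conj w) / (2 * s)).re := by
  rw [kernel, norm_mul, norm_div, norm_one, norm_csqrt, Complex.norm_exp, one_div]

/-- The modulus of the kernel, weighted in both variables. -/
noncomputable def weightedKernel (s t z w : ℂ) : ℝ :=
  ‖kernel s t z w‖ * Real.exp (-‖z‖ ^ 2 / 2) * Real.exp (-‖w‖ ^ 2 / 2)

/-- The point at which the weighted kernel `w ↦ weightedKernel s t z w` is maximal. -/
noncomputable def peak (s t z : ℂ) : ℂ :=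
  (conj s * z - conj t * conj z) / (‖s‖ ^ 2 - ‖t‖ ^ 2 : ℝ)

/-- Completion of the square in w about the critical point a, which is determined by z = s a + conj
t · conj a. Both quadratic forms on the right are positive definite when |t| < |s|, so only the sign
of 1 - 1/D matters afterwards. -/
theorem weightedKernel_eq {s t : ℂ} (hst : ‖t‖ < ‖s‖) (z w : ℂ) :
    weightedKernel s t z w = (Real.sqrt ‖s‖)⁻¹ * Real.exp
      (-(1 - 1 / (‖s‖ ^ 2 - ‖t‖ ^ 2)) / 2 * (‖z‖ ^ 2 - (t * z ^ 2 / s).re)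
        - (‖w - peak s t z‖ ^ 2 + (conj t * conj (w - peak s t z) ^ 2 / s).re) / 2) := by
  have hs : s ≠ 0 := norm_pos_iff.1 ((norm_nonneg t).trans_lt hst)
  have hD : (‖s‖ ^ 2 - ‖t‖ ^ 2 : ℝ) ≠ 0 := by
    have := norm_nonneg t
    nlinarith
  have hDc : ((‖s‖ ^ 2 - ‖t‖ ^ 2 : ℝ) : ℂ) = s * conj s - t * conj t := by
    rw [Complex.mul_conj, Complex.mul_conj, Complex.normSq_eq_norm_sq, Complex.normSq_eq_norm_sq]
    push_cast
    rfl
  have hDc0 : s * conj s - t * conj t ≠ 0 := by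
    rw [← hDc]
    exact_mod_cast hD
  set a := peak s t z with ha
  have ha' : a = (conj s * z - conj t * conj z) / (s * conj s - t * conj t) := by
    rw [ha, peak, hDc]
  have hac : conj a = (s * conj z - t * z) / (s * conj s - t * conj t) := by
    rw [ha']
    simp only [map_div₀, map_sub, map_mul, Complex.conj_conj]
    rw [mul_comm (conj s), mul_comm (conj t)]
  have hz : z = s * a + conj t * conj a := by
    rw [hac, ha', mul_div_assoc', mul_div_assoc', ← add_div, eq_div_iff hDc0]
    ring
  -- The exponent expanded about w = a. The real part of the last bracket is |w|² - |w - a|², which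
  -- cancels the weight e^{-|w|²/2}.
  have key : 2 * ((t * z ^ 2 - conj (t * w ^ 2) + 2 * z * conj w) / (2 * s))
      = t * z ^ 2 / s + z * conj a / s - conj t * conj (w - a) ^ 2 / s
        + (a * conj a + 2 * (a * conj (w - a))) := by
    have e : (t * z ^ 2 - conj (t * w ^ 2) + 2 * z * conj w)
        = t * z ^ 2 + z * conj a - conj t * conj (w - a) ^ 2
          + s * (a * conj a + 2 * (a * conj (w - a))) := by
      simp only [map_mul, map_pow, map_sub]
      linear_combination (2 * conj w - conj a) * hz
    rw [e]
    field_simp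
  have key2 : z * conj a / s = (z * conj z - t * z ^ 2 / s) / ((‖s‖ ^ 2 - ‖t‖ ^ 2 : ℝ) : ℂ) := by
    rw [hac, hDc]
    field_simp
  have key2' : (z * conj a / s).re
      = (‖z‖ ^ 2 - (t * z ^ 2 / s).re) / (‖s‖ ^ 2 - ‖t‖ ^ 2) := by
    rw [key2, Complex.div_ofReal_re, Complex.sub_re, Complex.mul_conj,
      Complex.normSq_eq_norm_sq, Complex.ofReal_re]
  have key3 : (a * conj a + 2 * (a * conj (w - a))).re = ‖w‖ ^ 2 - ‖w - a‖ ^ 2 := by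
    simp only [sq_norm_eq, Complex.add_re, Complex.mul_re, Complex.conj_re, Complex.conj_im,
      Complex.sub_re, Complex.sub_im, Complex.re_ofNat, Complex.im_ofNat, Complex.mul_im]
    ring
  have key4 := congrArg Complex.re key
  rw [Complex.add_re, Complex.sub_re, Complex.add_re, key2', key3] at key4
  have e2 : ∀ x : ℂ, (2 * x).re = 2 * x.re := fun x => by simp
  rw [e2] at key4
  rw [weightedKernel, norm_kernel, mul_assoc, mul_assoc, ← Real.exp_add, ← Real.exp_add]
  congr 2
  linear_combination key4 / 2

theorem abs_re_quadratic_le (s t v : ℂ) : |(t * v ^ 2 / s).re| ≤ ‖t‖ / ‖s‖ * ‖v‖ ^ 2 := by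
  refine (Complex.abs_re_le_norm _).trans (le_of_eq ?_)
  rw [norm_div, norm_mul, norm_pow]
  ring

theorem peak_sub (s t z z' : ℂ) : peak s t (z - z') = peak s t z - peak s t z' := by
  simp only [peak, map_sub]
  ring

theorem norm_peak_le {s t : ℂ} (hst : ‖t‖ < ‖s‖) (z : ℂ) :
    ‖peak s t z‖ ≤ (‖s‖ + ‖t‖) / (‖s‖ ^ 2 - ‖t‖ ^ 2) * ‖z‖ := by
  have hD : 0 < ‖s‖ ^ 2 - ‖t‖ ^ 2 := by
    have := norm_nonneg t
    nlinarith
  rw [peak, norm_div, Complex.norm_real, Real.norm_of_nonneg hD.le, div_mul_eq_mul_div]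
  gcongr
  refine (norm_sub_le _ _).trans (le_of_eq ?_)
  simp only [norm_mul, RCLike.norm_conj]
  ring

/-- This makes the peaks leave every compact set as |z| → ∞, and turns Gaussian decay in `peak s t
z` into Gaussian decay in z. -/
theorem le_norm_peak {s t : ℂ} (hD : ‖s‖ ^ 2 - ‖t‖ ^ 2 = 1) (z : ℂ) :
    (‖s‖ - ‖t‖) * ‖z‖ ≤ ‖peak s t z‖ := by
  rw [peak, hD, Complex.ofReal_one, div_one]
  refine le_trans (le_of_eq ?_) (norm_sub_norm_le _ _)
  simp only [norm_mul, RCLike.norm_conj]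
  ring

theorem peak_surjective {s t : ℂ} (hD : ‖s‖ ^ 2 - ‖t‖ ^ 2 = 1) (w : ℂ) :
    peak s t (s * w + conj t * conj w) = w := by
  have hDc : s * conj s - t * conj t = 1 := by
    rw [Complex.mul_conj, Complex.mul_conj, Complex.normSq_eq_norm_sq, Complex.normSq_eq_norm_sq]
    exact_mod_cast congrArg (fun x : ℝ => (x : ℂ)) hD
  rw [peak, hD, Complex.ofReal_one, div_one]
  simp only [map_add, map_mul, Complex.conj_conj]
  linear_combination w * hDc

theorem weightedKernel_nonneg (s t z w : ℂ) : 0 ≤ weightedKernel s t z w := by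
  unfold weightedKernel
  positivity

theorem ratio_pos {s t : ℂ} (hst : ‖t‖ < ‖s‖) : 0 < (1 - ‖t‖ / ‖s‖) / 2 := by
  have := (div_lt_one ((norm_nonneg t).trans_lt hst)).2 hst
  linarith

/-- Gaussian decay of the weighted kernel away from its peak. -/
theorem weightedKernel_le {s t : ℂ} (hst : ‖t‖ < ‖s‖) (hD : 1 ≤ ‖s‖ ^ 2 - ‖t‖ ^ 2) (z w : ℂ) :
    weightedKernel s t z w ≤ (Real.sqrt ‖s‖)⁻¹ * Real.exp
      (-((1 - 1 / (‖s‖ ^ 2 - ‖t‖ ^ 2)) * ((1 - ‖t‖ / ‖s‖) / 2) * ‖z‖ ^ 2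
        + (1 - ‖t‖ / ‖s‖) / 2 * ‖w - peak s t z‖ ^ 2)) := by
  rw [weightedKernel_eq hst]
  gcongr
  have h1 := abs_le.1 (abs_re_quadratic_le s t z)
  have h2 := abs_le.1 (abs_re_quadratic_le s (conj t) (conj (w - peak s t z)))
  rw [RCLike.norm_conj, RCLike.norm_conj] at h2
  have h3 : 0 ≤ 1 - 1 / (‖s‖ ^ 2 - ‖t‖ ^ 2) := by
    have := (div_le_one (zero_lt_one.trans_le hD)).2 hD
    linarith
  have h4 := mul_le_mul_of_nonneg_left h1.2 h3
  linarith [h2.1]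

/-- If `|s|² > |t|² + 1` then the weighted kernel decays like a Gaussian in both variables. -/
theorem exists_weightedKernel_le {s t : ℂ} (hst : ‖t‖ < ‖s‖) (hD : 1 < ‖s‖ ^ 2 - ‖t‖ ^ 2) :
    ∃ c ε : ℝ, 0 < c ∧ 0 < ε ∧ ∀ z w : ℂ, weightedKernel s t z w ≤
      c * Real.exp (-ε * ‖z‖ ^ 2) * Real.exp (-ε * ‖w‖ ^ 2) := by
  have hs : 0 < ‖s‖ := (norm_nonneg t).trans_lt hst
  set δ := (1 - ‖t‖ / ‖s‖) / 2 with hδ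
  have hδ0 : 0 < δ := ratio_pos hst
  set η := (1 - 1 / (‖s‖ ^ 2 - ‖t‖ ^ 2)) * δ
  have hη : 0 < η := by
    refine mul_pos ?_ hδ0
    have := (div_lt_one (zero_lt_one.trans hD)).2 hD
    linarith
  set b := (‖s‖ + ‖t‖) / (‖s‖ ^ 2 - ‖t‖ ^ 2)
  -- Since |w|² ≤ 2|w - a|² + 2b²|z|², the sum ε(|z|² + |w|²) costs at most 2ε|w - a|² + ε(1 +
  -- 2b²)|z|²; the two terms of the minimum pay for these.
  refine ⟨(Real.sqrt ‖s‖)⁻¹, min (δ / 2) (η / (1 + 2 * b ^ 2)), by positivity, by positivity,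
    fun z w => (weightedKernel_le hst hD.le z w).trans ?_⟩
  set ε := min (δ / 2) (η / (1 + 2 * b ^ 2))
  have hε1 : ε ≤ δ / 2 := min_le_left _ _
  have hε2 : ε * (1 + 2 * b ^ 2) ≤ η :=
    (le_div_iff₀ (by positivity)).1 (min_le_right _ _)
  have hε : 0 < ε := by positivity
  rw [mul_assoc _ (Real.exp _) (Real.exp _), ← Real.exp_add]
  gcongr
  rw [← hδ]
  set a := peak s t z
  have ha : ‖a‖ ^ 2 ≤ b ^ 2 * ‖z‖ ^ 2 := by
    rw [← mul_pow]
    exact pow_le_pow_left₀ (norm_nonneg _) (norm_peak_le hst z) 2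
  have hw : ‖w‖ ^ 2 ≤ 2 * ‖w - a‖ ^ 2 + 2 * ‖a‖ ^ 2 := by
    have h1 : ‖w‖ ≤ ‖w - a‖ + ‖a‖ := by simpa using norm_add_le (w - a) a
    have h2 := norm_nonneg w
    nlinarith [sq_nonneg (‖w - a‖ - ‖a‖)]
  have h5 : ε * ‖w‖ ^ 2 ≤ ε * (2 * ‖w - a‖ ^ 2 + 2 * (b ^ 2 * ‖z‖ ^ 2)) := by
    gcongr
    linarith
  have h6 := mul_le_mul_of_nonneg_right hε2 (sq_nonneg ‖z‖)
  have h7 := mul_le_mul_of_nonneg_right hε1 (sq_nonneg ‖w - a‖)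
  change -(η * ‖z‖ ^ 2 + _) ≤ _
  linarith

/-- Locally uniform Gaussian decay of the kernel in the variable of integration. -/
theorem exists_norm_kernel_le {s t : ℂ} (hst : ‖t‖ < ‖s‖) :
    ∃ b δ : ℝ, 0 < b ∧ 0 < δ ∧ ∀ z w : ℂ, ‖kernel s t z w‖ * Real.exp (-‖w‖ ^ 2 / 2) ≤
      (Real.sqrt ‖s‖)⁻¹ * Real.exp (b * ‖z‖ ^ 2) * Real.exp (-δ * ‖w‖ ^ 2) := by
  have hs : 0 < ‖s‖ := (norm_nonneg t).trans_lt hst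
  have hs0 : s ≠ 0 := norm_pos_iff.1 hs
  set δ := (1 - ‖t‖ / ‖s‖) / 2 with hδ
  have hδ0 : 0 < δ := ratio_pos hst
  -- The quadratic term together with the weight leaves -δ|w|². Half of it absorbs the mixed term
  -- |z||w|/|s|, at the price of |z|²/(2δ|s|²).
  refine ⟨1 / 2 + 1 / (2 * δ * ‖s‖ ^ 2), δ / 2, by positivity, by positivity, fun z w => ?_⟩
  rw [norm_kernel, mul_assoc, mul_assoc _ (Real.exp _) (Real.exp _), ← Real.exp_add,
    ← Real.exp_add]
  refine mul_le_mul_of_nonneg_left (Real.exp_le_exp.2 ?_) (by positivity)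
  have e : (t * z ^ 2 - conj (t * w ^ 2) + 2 * z * conj w) / (2 * s)
      = (1 / 2 : ℝ) * (t * z ^ 2 / s) - (1 / 2 : ℝ) * (conj t * conj w ^ 2 / s)
        + z * conj w / s := by
    rw [map_mul, map_pow]
    push_cast
    field_simp
  rw [e, Complex.add_re, Complex.sub_re, Complex.re_ofReal_mul, Complex.re_ofReal_mul]
  have h1 := abs_le.1 (abs_re_quadratic_le s t z)
  have h2 := abs_le.1 (abs_re_quadratic_le s (conj t) (conj w))
  rw [RCLike.norm_conj, RCLike.norm_conj] at h2
  have h3 : (z * conj w / s).re ≤ ‖z‖ * ‖w‖ / ‖s‖ := by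
    refine (Complex.re_le_norm _).trans (le_of_eq ?_)
    rw [norm_div, norm_mul, RCLike.norm_conj]
  have h4 : ‖z‖ * ‖w‖ / ‖s‖ ≤ δ / 2 * ‖w‖ ^ 2 + 1 / (2 * δ * ‖s‖ ^ 2) * ‖z‖ ^ 2 := by
    have : 0 ≤ δ / 2 * (‖w‖ - ‖z‖ / (δ * ‖s‖)) ^ 2 := by positivity
    have e3 : δ / 2 * (‖w‖ - ‖z‖ / (δ * ‖s‖)) ^ 2
      = δ / 2 * ‖w‖ ^ 2 + 1 / (2 * δ * ‖s‖ ^ 2) * ‖z‖ ^ 2 - ‖z‖ * ‖w‖ / ‖s‖ := by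
      field_simp
      ring
    linarith
  have h5 : ‖t‖ / ‖s‖ * ‖z‖ ^ 2 ≤ 1 * ‖z‖ ^ 2 := by
    gcongr
    exact (div_lt_one hs).2 hst |>.le
  have h6 : ‖t‖ / ‖s‖ * ‖w‖ ^ 2 = ‖w‖ ^ 2 - 2 * δ * ‖w‖ ^ 2 := by
    rw [hδ]; ring
  linarith [h1.2, h2.1]

/-! ### Convergence of the integral and holomorphy of the transform -/

theorem integrable_exp_neg_mul_sq_norm {b : ℝ} (hb : 0 < b) :
    Integrable (fun w : ℂ => Real.exp (-b * ‖w‖ ^ 2)) := by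
  have := (GaussianFourier.integrable_cexp_neg_mul_sq_norm_add (V := ℂ) (b := (b : ℂ))
    (by simpa using hb) 0 0).norm
  refine this.congr (ae_of_all _ fun w => ?_)
  simp [Complex.norm_exp, ← Complex.ofReal_pow, ← Complex.ofReal_mul, ← Complex.ofReal_neg]

theorem memLp_exp_neg_mul_sq_norm {b : ℝ} (hb : 0 < b) {p : ℝ≥0∞} (hp : 0 < p) :
    MemLp (fun w : ℂ => Real.exp (-b * ‖w‖ ^ 2)) p volume := by
  have hc : Continuous fun w : ℂ => Real.exp (-b * ‖w‖ ^ 2) := by fun_prop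
  by_cases hpt : p = ∞
  · subst hpt
    refine memLp_top_of_bound hc.aestronglyMeasurable 1 (ae_of_all _ fun w => ?_)
    rw [Real.norm_of_nonneg (Real.exp_pos _).le, Real.exp_le_one_iff]
    have : 0 ≤ b * ‖w‖ ^ 2 := by positivity
    linarith
  · have hq : 0 < p.toReal := ENNReal.toReal_pos hp.ne' hpt
    rw [← integrable_norm_rpow_iff hc.aestronglyMeasurable hp.ne' hpt]
    refine (integrable_exp_neg_mul_sq_norm (mul_pos hb hq)).congr (ae_of_all _ fun w => ?_)
    change _ = ‖Real.exp _‖ ^ p.toReal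
    rw [Real.norm_of_nonneg (Real.exp_pos _).le, ← Real.exp_mul]
    ring_nf

theorem norm_weighted (f : ℂ → ℂ) (w : ℂ) :
    ‖weighted f w‖ = ‖f w‖ * Real.exp (-‖w‖ ^ 2 / 2) := by
  rw [weighted, norm_mul, Complex.norm_real, Real.norm_of_nonneg (Real.exp_pos _).le]

theorem integrable_gaussian_iff {g : ℂ → ℂ} : Integrable g gaussian ↔
    Integrable (fun w => (1 / Real.pi * Real.exp (-‖w‖ ^ 2)) • g w) := by
  rw [gaussian, integrable_withDensity_iff_integrable_smul' (by fun_prop)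
    (ae_of_all _ fun _ => ENNReal.ofReal_lt_top)]
  refine integrable_congr (ae_of_all _ fun w => ?_)
  simp only
  rw [ENNReal.toReal_ofReal (by positivity)]

theorem integral_gaussian (g : ℂ → ℂ) : ∫ w, g w ∂gaussian =
    ∫ w, (1 / Real.pi * Real.exp (-‖w‖ ^ 2)) • g w := by
  rw [gaussian, integral_withDensity_eq_integral_toReal_smul (by fun_prop)
    (ae_of_all _ fun _ => ENNReal.ofReal_lt_top)]
  refine integral_congr_ae (ae_of_all _ fun w => ?_)
  simp only
  rw [ENNReal.toReal_ofReal (by positivity)]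

theorem norm_gaussian_smul (k : ℂ) (f : ℂ → ℂ) (w : ℂ) :
    ‖(1 / Real.pi * Real.exp (-‖w‖ ^ 2)) • (k * f w)‖
      = 1 / Real.pi * (‖k‖ * Real.exp (-‖w‖ ^ 2 / 2) * ‖weighted f w‖) := by
  have e : Real.exp (-‖w‖ ^ 2) = Real.exp (-‖w‖ ^ 2 / 2) * Real.exp (-‖w‖ ^ 2 / 2) := by
    rw [← Real.exp_add]
    congr 1
    ring
  rw [norm_smul, norm_mul k, Real.norm_of_nonneg (by positivity), norm_weighted, e]
  ring

theorem exists_norm_weighted_le {p : ℝ≥0∞} (hp : 0 < p) {f : ℂ → ℂ} (hf : f ∈ Fock p) :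
    ∃ M : ℝ, 0 ≤ M ∧ ∀ w, ‖weighted f w‖ ≤ M := by
  obtain ⟨C, hC⟩ := exists_enorm_weighted_le hp
  refine ⟨(C * eLpNorm (weighted f) p volume).toReal, ENNReal.toReal_nonneg, fun w => ?_⟩
  have hfin : (C : ℝ≥0∞) * eLpNorm (weighted f) p volume ≠ ∞ :=
    ENNReal.mul_ne_top ENNReal.coe_ne_top hf.2.eLpNorm_ne_top
  have := ENNReal.toReal_mono hfin (hC f hf.1 w)
  simpa using this

/-- Bounded point evaluations reduce convergence and holomorphy for every exponent to the case p =
∞. -/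
theorem fock_le_fock_top {p : ℝ≥0∞} (hp : 0 < p) : Fock p ≤ Fock ∞ := by
  intro f hf
  obtain ⟨M, _, hM⟩ := exists_norm_weighted_le hp hf
  exact ⟨hf.1, memLp_top_of_bound (continuous_weighted hf.1.continuous).aestronglyMeasurable M
    (ae_of_all _ hM)⟩

theorem continuous_kernel_right (s t z : ℂ) : Continuous (kernel s t z) := by
  unfold kernel
  have := Complex.continuous_conj
  fun_prop

theorem integrable_kernel_mul {s t : ℂ} (hst : ‖t‖ < ‖s‖) {f : ℂ → ℂ} (hf : f ∈ Fock ∞) (z : ℂ) :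
    Integrable (fun w => (1 / Real.pi * Real.exp (-‖w‖ ^ 2)) • (kernel s t z w * f w)) := by
  obtain ⟨M, hM0, hM⟩ := exists_norm_weighted_le ENNReal.zero_lt_top hf
  obtain ⟨b, δ, hb, hδ, hK⟩ := exists_norm_kernel_le hst
  have hfc := hf.1.continuous
  have hkc := continuous_kernel_right s t z
  refine Integrable.mono' (((integrable_exp_neg_mul_sq_norm hδ).const_mul
    (1 / Real.pi * ((Real.sqrt ‖s‖)⁻¹ * Real.exp (b * ‖z‖ ^ 2)) * M)))
    (by fun_prop : Continuous _).aestronglyMeasurable (ae_of_all _ fun w => ?_)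
  rw [norm_gaussian_smul]
  calc 1 / Real.pi * (‖kernel s t z w‖ * Real.exp (-‖w‖ ^ 2 / 2) * ‖weighted f w‖)
      ≤ 1 / Real.pi * ((Real.sqrt ‖s‖)⁻¹ * Real.exp (b * ‖z‖ ^ 2) * Real.exp (-δ * ‖w‖ ^ 2)
        * M) :=
        mul_le_mul_of_nonneg_left (mul_le_mul (hK z w) (hM w) (norm_nonneg _) (by positivity))
          (by positivity)
    _ = _ := by ring

theorem hasDerivAt_kernel (s t z w : ℂ) :
    HasDerivAt (fun z => kernel s t z w)
      (kernel s t z w * ((t * (2 * z) + 2 * conj w) / (2 * s))) z := by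
  unfold kernel
  have h1 : HasDerivAt (fun z : ℂ => (t * z ^ 2 - conj (t * w ^ 2) + 2 * z * conj w) / (2 * s))
      ((t * (2 * z) + 2 * conj w) / (2 * s)) z := by
    have h2 : HasDerivAt (fun z : ℂ => t * z ^ 2) (t * (2 * z)) z := by
      simpa using (hasDerivAt_pow 2 z).const_mul t
    have h3 : HasDerivAt (fun z : ℂ => 2 * z * conj w) (2 * conj w) z := by
      simpa using ((hasDerivAt_id z).const_mul 2).mul_const (conj w)
    exact ((h2.sub_const _).add h3).div_const _
  have := h1.cexp.const_mul (1 / csqrt s)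
  rw [mul_assoc]
  exact this

theorem differentiable_canonicalOp {s t : ℂ} (hst : ‖t‖ < ‖s‖) {f : ℂ → ℂ} (hf : f ∈ Fock ∞) :
    Differentiable ℂ (canonicalOp s t f) := by
  intro z₀
  have hs : 0 < ‖s‖ := (norm_nonneg t).trans_lt hst
  obtain ⟨M, hM0, hM⟩ := exists_norm_weighted_le ENNReal.zero_lt_top hf
  obtain ⟨b, δ, hb, hδ, hK⟩ := exists_norm_kernel_le hst
  have hfc := hf.1.continuous
  set R := ‖z₀‖ + 1 with hR
  have hR0 : 0 < R := by positivity
  have he : canonicalOp s t f = fun z =>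
      ∫ w, (1 / Real.pi * Real.exp (-‖w‖ ^ 2)) • (kernel s t z w * f w) := by
    funext z
    rw [canonicalOp, integral_gaussian]
  rw [he]
  -- Differentiating the kernel in z costs a factor linear in |w|, which is at most A e^{δ|w|²/2}
  -- for |z| ≤ R; half of the Gaussian decay remains for the dominating function.
  set A : ℝ := (2 * ‖t‖ * R + 2 * (1 + 2 / δ)) / (2 * ‖s‖)
  refine (hasDerivAt_integral_of_dominated_loc_of_deriv_le (μ := (volume : Measure ℂ))
    (F := fun z w => (1 / Real.pi * Real.exp (-‖w‖ ^ 2)) • (kernel s t z w * f w))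
    (F' := fun z w => (1 / Real.pi * Real.exp (-‖w‖ ^ 2)) •
      (kernel s t z w * ((t * (2 * z) + 2 * conj w) / (2 * s)) * f w))
    (bound := fun w => (1 / Real.pi * ((Real.sqrt ‖s‖)⁻¹ * Real.exp (b * R ^ 2)) * M * A) *
      Real.exp (-(δ / 2) * ‖w‖ ^ 2))
    (Metric.ball_mem_nhds z₀ one_pos) (Eventually.of_forall fun z =>
      (integrable_kernel_mul hst hf z).aestronglyMeasurable) (integrable_kernel_mul hst hf z₀)
    ?_ (ae_of_all _ fun w z hz => ?_) ((integrable_exp_neg_mul_sq_norm (by positivity)).const_mul _)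
    (ae_of_all _ fun w z _ => ?_)).2.differentiableAt
  · have hkc := continuous_kernel_right s t z₀
    have := Complex.continuous_conj
    exact (by fun_prop : Continuous _).aestronglyMeasurable
  · have hzR : ‖z‖ ≤ R := by
      have : ‖z‖ ≤ ‖z₀‖ + ‖z - z₀‖ := by simpa using norm_add_le z₀ (z - z₀)
      rw [mem_ball_iff_norm] at hz
      linarith
    have hw : ‖w‖ ≤ (1 + 2 / δ) * Real.exp (δ / 2 * ‖w‖ ^ 2) := by
      have h1 := Real.add_one_le_exp (δ / 2 * ‖w‖ ^ 2)
      have h2 : ‖w‖ ≤ 1 + ‖w‖ ^ 2 := by nlinarith [sq_nonneg (‖w‖ - 1), norm_nonneg w]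
      have h3 : 1 + ‖w‖ ^ 2 ≤ (1 + 2 / δ) * (δ / 2 * ‖w‖ ^ 2 + 1) := by
        have : (1 + 2 / δ) * (δ / 2 * ‖w‖ ^ 2 + 1)
          = 1 + ‖w‖ ^ 2 + (δ / 2 * ‖w‖ ^ 2 + 2 / δ) := by
          field_simp
          ring
        rw [this]
        have : 0 ≤ δ / 2 * ‖w‖ ^ 2 + 2 / δ := by positivity
        linarith
      exact h2.trans (h3.trans (by gcongr))
    have hexp1 : 1 ≤ Real.exp (δ / 2 * ‖w‖ ^ 2) := Real.one_le_exp (by positivity)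
    have hlin : ‖(t * (2 * z) + 2 * conj w) / (2 * s)‖ ≤ A * Real.exp (δ / 2 * ‖w‖ ^ 2) := by
      rw [norm_div, norm_mul 2 s, Complex.norm_ofNat, div_mul_eq_mul_div]
      gcongr
      calc ‖t * (2 * z) + 2 * conj w‖ ≤ ‖t * (2 * z)‖ + ‖2 * conj w‖ := norm_add_le _ _
        _ = 2 * ‖t‖ * ‖z‖ * 1 + 2 * ‖w‖ := by
            simp only [norm_mul, RCLike.norm_conj, Complex.norm_ofNat]
            ring
        _ ≤ 2 * ‖t‖ * R * Real.exp (δ / 2 * ‖w‖ ^ 2)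
            + 2 * ((1 + 2 / δ) * Real.exp (δ / 2 * ‖w‖ ^ 2)) := by gcongr
        _ = _ := by ring
    rw [norm_gaussian_smul, norm_mul]
    calc 1 / Real.pi * (‖kernel s t z w‖ * ‖(t * (2 * z) + 2 * conj w) / (2 * s)‖ *
          Real.exp (-‖w‖ ^ 2 / 2) * ‖weighted f w‖)
        = 1 / Real.pi * (‖kernel s t z w‖ * Real.exp (-‖w‖ ^ 2 / 2) *
          (‖(t * (2 * z) + 2 * conj w) / (2 * s)‖ * ‖weighted f w‖)) := by ring
      _ ≤ 1 / Real.pi * (((Real.sqrt ‖s‖)⁻¹ * Real.exp (b * R ^ 2) * Real.exp (-δ * ‖w‖ ^ 2)) *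
          ((A * Real.exp (δ / 2 * ‖w‖ ^ 2)) * M)) := by
          refine mul_le_mul_of_nonneg_left (mul_le_mul ((hK z w).trans (by gcongr))
            (mul_le_mul hlin (hM w) (norm_nonneg _) (by positivity)) (by positivity)
            (by positivity)) (by positivity)
      _ = (1 / Real.pi * ((Real.sqrt ‖s‖)⁻¹ * Real.exp (b * R ^ 2)) * M * A) *
          (Real.exp (-δ * ‖w‖ ^ 2) * Real.exp (δ / 2 * ‖w‖ ^ 2)) := by ring
      _ = _ := by
          rw [← Real.exp_add]
          ring_nf
  · exact ((hasDerivAt_kernel s t z w).mul_const (f w)).const_smul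
      (1 / Real.pi * Real.exp (-‖w‖ ^ 2))

/-- The density e^{-|w|²} splits into two halves, one weighting the kernel and one weighting f. -/
theorem enorm_weighted_canonicalOp_le (s t : ℂ) (f : ℂ → ℂ) (z : ℂ) :
    ‖weighted (canonicalOp s t f) z‖ₑ ≤ ENNReal.ofReal (1 / Real.pi) *
      ∫⁻ w, ENNReal.ofReal (weightedKernel s t z w) * ‖weighted f w‖ₑ := by
  have hpi : 0 ≤ 1 / Real.pi := by positivity
  rw [weighted, enorm_mul, canonicalOp, integral_gaussian, mul_comm]
  calc ‖(Real.exp (-‖z‖ ^ 2 / 2) : ℂ)‖ₑ *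
        ‖∫ w, (1 / Real.pi * Real.exp (-‖w‖ ^ 2)) • (kernel s t z w * f w)‖ₑ
      ≤ ‖(Real.exp (-‖z‖ ^ 2 / 2) : ℂ)‖ₑ *
        ∫⁻ w, ‖(1 / Real.pi * Real.exp (-‖w‖ ^ 2)) • (kernel s t z w * f w)‖ₑ := by
        gcongr
        exact enorm_integral_le_lintegral_enorm _
    _ = ∫⁻ w, ENNReal.ofReal (1 / Real.pi) *
        (ENNReal.ofReal (weightedKernel s t z w) * ‖weighted f w‖ₑ) := by
        rw [← lintegral_const_mul' _ _ enorm_ne_top]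
        refine lintegral_congr fun w => ?_
        rw [← ofReal_norm, ← ofReal_norm, norm_gaussian_smul, ← ofReal_norm,
          ← ENNReal.ofReal_mul (weightedKernel_nonneg _ _ _ _), ← ENNReal.ofReal_mul hpi,
          ← ENNReal.ofReal_mul (norm_nonneg _), Complex.norm_real,
          Real.norm_of_nonneg (Real.exp_pos _).le, weightedKernel]
        ring_nf
    _ = _ := lintegral_const_mul' _ _ ENNReal.ofReal_ne_top

/-! ### The reproducing formula and the test functions -/

/-- The reproducing formula for entire functions. -/
theorem integral_mul_exp_conj {h : ℂ → ℂ} (hh : Differentiable ℂ h) (a : ℂ)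
    (hi : Integrable fun w : ℂ => h w * Complex.exp (conj w * a - (‖w‖ ^ 2 : ℝ))) :
    ∫ w : ℂ, h w * Complex.exp (conj w * a - (‖w‖ ^ 2 : ℝ)) = Real.pi * h a := by
  set g : ℂ → ℂ := fun w => h w * Complex.exp (conj w * a - (‖w‖ ^ 2 : ℝ)) with hg
  set φ : ℝ → ℝ := fun r => Real.exp (-1 * r ^ 2) with hφ
  -- With w = a + u the exponent becomes -conj a · u - |u|²: an entire factor times a radial
  -- Gaussian, so the mean value property applies.
  set k : ℂ → ℂ := fun u => h (a + u) * Complex.exp (-(conj a * u)) with hk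
  have hkd : Differentiable ℂ k := by
    refine (hh.comp ((differentiable_const a).add differentiable_id)).mul ?_
    fun_prop
  have he : ∀ u, g (a + u) = k u * (φ ‖u‖ : ℂ) := by
    intro u
    simp only [hg, hk, hφ, Complex.ofReal_exp]
    rw [mul_assoc, ← Complex.exp_add]
    congr 2
    have h1 : ∀ z : ℂ, ((‖z‖ ^ 2 : ℝ) : ℂ) = z * conj z := fun z => by
      rw [Complex.mul_conj, Complex.normSq_eq_norm_sq]
    rw [h1, Complex.ofReal_mul, h1, map_add]
    push_cast
    ring
  have h1 := integral_mul_radial hkd (φ := φ) (by fun_prop) (by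
    simp_rw [← he]
    exact hi.comp_add_left a)
  simp_rw [← he] at h1
  rw [integral_add_left_eq_self g a] at h1
  have h2 : ∫ w : ℂ, (φ ‖w‖ : ℂ) = Real.pi := by
    rw [integral_complex_ofReal]
    simp only [hφ]
    rw [GaussianFourier.integral_rexp_neg_mul_sq_norm one_pos]
    simp
  rw [h1, h2]
  simp [hk, mul_comm]

/-- The normalized reproducing kernel of the Fock space at `a`. -/
noncomputable def coherent (a w : ℂ) : ℂ :=
  Complex.exp (conj a * w - (‖a‖ ^ 2 / 2 : ℝ))

theorem differentiable_coherent (a : ℂ) : Differentiable ℂ (coherent a) := by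
  unfold coherent
  fun_prop

theorem norm_weighted_coherent (a w : ℂ) :
    ‖weighted (coherent a) w‖ = Real.exp (-(1 / 2) * ‖-a + w‖ ^ 2) := by
  rw [norm_weighted, coherent, Complex.norm_exp, ← Real.exp_add]
  congr 1
  simp only [sq_norm_eq, Complex.sub_re, Complex.mul_re, Complex.conj_re, Complex.conj_im,
    Complex.ofReal_re, Complex.add_re, Complex.add_im, Complex.neg_re, Complex.neg_im]
  ring

theorem eLpNorm_weighted_coherent (p : ℝ≥0∞) (a : ℂ) :
    eLpNorm (weighted (coherent a)) p volume
      = eLpNorm (fun w : ℂ => Real.exp (-(1 / 2) * ‖w‖ ^ 2)) p volume := by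
  set F : ℂ → ℂ := fun w => (Real.exp (-(1 / 2) * ‖w‖ ^ 2) : ℂ) with hF
  have hFc : Continuous F := by fun_prop
  calc eLpNorm (weighted (coherent a)) p volume
      = eLpNorm (fun w => F (-a + w)) p volume := by
        refine eLpNorm_congr_norm_ae (ae_of_all _ fun w => ?_)
        rw [norm_weighted_coherent]
        simp only [hF, Complex.norm_real]
        rw [Real.norm_of_nonneg (Real.exp_pos _).le]
    _ = eLpNorm F p volume := eLpNorm_comp_add_left hFc p (-a)
    _ = _ := eLpNorm_congr_norm_ae (ae_of_all _ fun w => by simp only [hF, Complex.norm_real])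

theorem coherent_mem_fock {p : ℝ≥0∞} (hp : 0 < p) (a : ℂ) : coherent a ∈ Fock p := by
  refine ⟨differentiable_coherent a,
    (continuous_weighted (differentiable_coherent a).continuous).aestronglyMeasurable, ?_⟩
  rw [eLpNorm_weighted_coherent]
  exact (memLp_exp_neg_mul_sq_norm (by norm_num) hp).2

theorem differentiable_conj_kernel (s t z : ℂ) : Differentiable ℂ fun w => conj (kernel s t z w) := by
  have : (fun w => conj (kernel s t z w)) = fun w => conj (1 / csqrt s) *
      Complex.exp ((conj (t * z ^ 2) - t * w ^ 2 + 2 * conj z * w) / (2 * conj s)) := by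
    funext w
    have h2 : conj (2 : ℂ) = 2 := Complex.conj_ofNat 2
    rw [kernel, map_mul, ← Complex.exp_conj]
    simp [h2]
  rw [this]
  fun_prop

/-- The kernel is antiholomorphic in w, so its conjugate is entire; the conjugated integral is then
an instance of the reproducing formula at a. -/
theorem canonicalOp_coherent {s t : ℂ} (hst : ‖t‖ < ‖s‖) (z a : ℂ) :
    canonicalOp s t (coherent a) z = kernel s t z a * (Real.exp (-‖a‖ ^ 2 / 2) : ℂ) := by
  set E : ℂ := (Real.exp (-‖a‖ ^ 2 / 2) : ℂ) with hE
  have he : ∀ w, (1 / Real.pi * Real.exp (-‖w‖ ^ 2)) • (kernel s t z w * coherent a w)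
      = (E / Real.pi) * conj (conj (kernel s t z w) *
        Complex.exp (conj w * a - (‖w‖ ^ 2 : ℝ))) := by
    intro w
    rw [map_mul, Complex.conj_conj, ← Complex.exp_conj, Complex.real_smul, map_sub, map_mul,
      Complex.conj_conj, Complex.conj_ofReal, hE, coherent, Complex.exp_sub, Complex.exp_sub]
    have h1 : (Real.exp (-‖a‖ ^ 2 / 2) : ℂ) = (Complex.exp (‖a‖ ^ 2 / 2 : ℝ))⁻¹ := by
      rw [← Complex.exp_neg, Complex.ofReal_exp]
      congr 1
      push_cast
      ring
    have h2 : ((1 / Real.pi * Real.exp (-‖w‖ ^ 2) : ℝ) : ℂ)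
        = (1 / Real.pi) * (Complex.exp (‖w‖ ^ 2 : ℝ))⁻¹ := by
      rw [← Complex.exp_neg]
      push_cast
      rfl
    rw [h1, h2, mul_comm w (conj a)]
    ring
  have hpi : (Real.pi : ℂ) ≠ 0 := by exact_mod_cast Real.pi_ne_zero
  have hE0 : E ≠ 0 := by
    rw [hE]
    exact_mod_cast (Real.exp_pos _).ne'
  have hi := integrable_kernel_mul hst (coherent_mem_fock ENNReal.zero_lt_top a) z
  simp_rw [he] at hi
  have hi2 : Integrable (fun w => conj (kernel s t z w) *
      Complex.exp (conj w * a - (‖w‖ ^ 2 : ℝ))) := by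
    have h3 := (integrable_const_mul_iff (div_ne_zero hE0 hpi).isUnit _).1 hi
    have h4 := Complex.conjCLE.toContinuousLinearMap.integrable_comp h3
    simpa using h4
  rw [canonicalOp, integral_gaussian]
  simp_rw [he]
  rw [integral_const_mul, integral_conj, integral_mul_exp_conj (differentiable_conj_kernel s t z) a
    hi2, map_mul, Complex.conj_conj, Complex.conj_ofReal]
  field_simp

theorem norm_weighted_canonicalOp_coherent {s t : ℂ} (hst : ‖t‖ < ‖s‖) (z a : ℂ) :
    ‖weighted (canonicalOp s t (coherent a)) z‖ = weightedKernel s t z a := by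
  rw [norm_weighted, canonicalOp_coherent hst, norm_mul, Complex.norm_real,
    Real.norm_of_nonneg (Real.exp_pos _).le, weightedKernel]
  ring

/-! ### Passing from norm estimates to bounded maps and back -/

theorem exists_linearMap {s t : ℂ} (hst : ‖t‖ < ‖s‖) {p : ℝ≥0∞} (hp : 0 < p)
    (hmem : ∀ f ∈ Fock p, canonicalOp s t f ∈ Fock p) :
    ∃ L : Fock p →ₗ[ℂ] Fock p, ∀ f : Fock p, (L f : ℂ → ℂ) = canonicalOp s t f := by
  have hint : ∀ f ∈ Fock p, ∀ z, Integrable (fun w => kernel s t z w * f w) gaussian :=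
    fun f hf z => integrable_gaussian_iff.2 (integrable_kernel_mul hst (fock_le_fock_top hp hf) z)
  refine ⟨{ toFun := fun f => ⟨canonicalOp s t f, hmem f f.2⟩, map_add' := ?_, map_smul' := ?_ },
    fun f => rfl⟩
  · intro f g
    ext z
    simp only [canonicalOp, Submodule.coe_add, Pi.add_apply, mul_add]
    exact integral_add (hint f f.2 z) (hint g g.2 z)
  · intro c f
    ext z
    simp only [canonicalOp, Submodule.coe_smul, Pi.smul_apply, smul_eq_mul, RingHom.id_apply,
      ← integral_const_mul]
    congr 1
    funext w
    ring

theorem exists_isBoundedMap {s t : ℂ} (hst : ‖t‖ < ‖s‖) {p : ℝ≥0∞} (hp : 0 < p) {C : ℝ≥0}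
    (hC : ∀ f ∈ Fock p, eLpNorm (weighted (canonicalOp s t f)) p volume
      ≤ C * eLpNorm (weighted f) p volume) :
    ∃ L : Fock p →ₗ[ℂ] Fock p,
      (∀ f : Fock p, (L f : ℂ → ℂ) = canonicalOp s t f) ∧ IsBoundedMap L := by
  have hd : ∀ f ∈ Fock p, Differentiable ℂ (canonicalOp s t f) :=
    fun f hf => differentiable_canonicalOp hst (fock_le_fock_top hp hf)
  obtain ⟨L, hL⟩ := exists_linearMap hst hp fun f hf => by
    refine ⟨hd f hf, (continuous_weighted (hd f hf).continuous).aestronglyMeasurable,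
      (hC f hf).trans_lt (ENNReal.mul_lt_top ENNReal.coe_lt_top hf.2.2)⟩
  refine ⟨L, hL, C, fun f => ?_⟩
  obtain ⟨c, _, hc⟩ := exists_fockNorm_eq hp
  rw [hL f, hc _ (hd f f.2).continuous, hc _ f.2.1.continuous, mul_left_comm]
  gcongr
  exact hC f f.2

theorem IsBoundedMap.exists_eLpNorm_le {p : ℝ≥0∞} (hp : 0 < p) {L : Fock p →ₗ[ℂ] Fock p}
    (hL : IsBoundedMap L) : ∃ C : ℝ≥0, ∀ f : Fock p,
      eLpNorm (weighted (L f)) p volume ≤ C * eLpNorm (weighted f) p volume := by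
  obtain ⟨C, hC⟩ := hL
  obtain ⟨c, hc0, hc⟩ := exists_fockNorm_eq hp
  refine ⟨C, fun f => ?_⟩
  have h := hC f
  rw [hc _ (L f).2.1.continuous, hc _ f.2.1.continuous, mul_left_comm] at h
  exact (ENNReal.mul_le_mul_iff_right (by simpa using hc0) ENNReal.coe_ne_top).1 h

/-! ### Decay of the kernel in both variables -/

/-- The kernel bound separates the variables, so the transform is dominated pointwise by one fixed
Gaussian times a single integral of f. No triangle inequality in L^p is needed, hence p < 1 is
included. -/
theorem eLpNorm_canonicalOp_le_of_weightedKernel_le {s t : ℂ} {c ε : ℝ} (hc : 0 < c)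
    (hK : ∀ z w : ℂ, weightedKernel s t z w ≤
      c * Real.exp (-ε * ‖z‖ ^ 2) * Real.exp (-ε * ‖w‖ ^ 2)) (p : ℝ≥0∞) {f : ℂ → ℂ}
    (hJ : ∫⁻ w, ENNReal.ofReal (Real.exp (-ε * ‖w‖ ^ 2)) * ‖weighted f w‖ₑ ≠ ∞) :
    eLpNorm (weighted (canonicalOp s t f)) p volume ≤
      ENNReal.ofReal (1 / Real.pi * c) *
        (∫⁻ w, ENNReal.ofReal (Real.exp (-ε * ‖w‖ ^ 2)) * ‖weighted f w‖ₑ) *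
        eLpNorm (fun z : ℂ => Real.exp (-ε * ‖z‖ ^ 2)) p volume := by
  set J := ∫⁻ w, ENNReal.ofReal (Real.exp (-ε * ‖w‖ ^ 2)) * ‖weighted f w‖ₑ with hJdef
  have hpt : ∀ z, ‖weighted (canonicalOp s t f) z‖ₑ ≤
      ENNReal.ofReal (1 / Real.pi * c) * J * ‖Real.exp (-ε * ‖z‖ ^ 2)‖ₑ := by
    intro z
    refine (enorm_weighted_canonicalOp_le s t f z).trans ?_
    rw [Real.enorm_of_nonneg (Real.exp_pos _).le]
    calc ENNReal.ofReal (1 / Real.pi) *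
          ∫⁻ w, ENNReal.ofReal (weightedKernel s t z w) * ‖weighted f w‖ₑ
        ≤ ENNReal.ofReal (1 / Real.pi) * ∫⁻ w, ENNReal.ofReal (c * Real.exp (-ε * ‖z‖ ^ 2)) *
          (ENNReal.ofReal (Real.exp (-ε * ‖w‖ ^ 2)) * ‖weighted f w‖ₑ) := by
          refine mul_le_mul_right (lintegral_mono fun w => ?_) _
          rw [← mul_assoc, ← ENNReal.ofReal_mul (by positivity)]
          exact mul_le_mul_left (ENNReal.ofReal_le_ofReal (hK z w)) _
      _ = _ := by
          rw [lintegral_const_mul' _ _ ENNReal.ofReal_ne_top, ← hJdef,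
            ENNReal.ofReal_mul hc.le, ENNReal.ofReal_mul (by positivity)]
          ring
  set k : ℝ≥0 := (ENNReal.ofReal (1 / Real.pi * c) * J).toNNReal
  have hk : (k : ℝ≥0∞) = ENNReal.ofReal (1 / Real.pi * c) * J :=
    ENNReal.coe_toNNReal (ENNReal.mul_ne_top ENNReal.ofReal_ne_top hJ)
  rw [← hk] at hpt ⊢
  refine (eLpNorm_le_nnreal_smul_eLpNorm_of_ae_le_mul (c := k) (ae_of_all _ fun z => ?_) p).trans
    (le_of_eq (by rw [ENNReal.smul_def, smul_eq_mul]))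
  have := hpt z
  rw [enorm_eq_nnnorm, enorm_eq_nnnorm] at this
  exact_mod_cast this

theorem lintegral_exp_neg_mul_sq_norm_ne_top {ε : ℝ} (hε : 0 < ε) :
    ∫⁻ w : ℂ, ENNReal.ofReal (Real.exp (-ε * ‖w‖ ^ 2)) ≠ ∞ := by
  have := (integrable_exp_neg_mul_sq_norm hε).lintegral_lt_top
  exact this.ne

theorem lintegral_exp_mul_le {ε : ℝ} {f : ℂ → ℂ} {M : ℝ≥0∞} (hM : ∀ w, ‖weighted f w‖ₑ ≤ M) :
    ∫⁻ w, ENNReal.ofReal (Real.exp (-ε * ‖w‖ ^ 2)) * ‖weighted f w‖ₑ ≤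
      (∫⁻ w : ℂ, ENNReal.ofReal (Real.exp (-ε * ‖w‖ ^ 2))) * M := by
  rw [← lintegral_mul_const _ (by fun_prop)]
  exact lintegral_mono fun w => mul_le_mul_right (hM w) _

theorem compactOn_of_one_lt {s t : ℂ} (hst : ‖t‖ < ‖s‖) (hD : 1 < ‖s‖ ^ 2 - ‖t‖ ^ 2)
    {p : ℝ≥0∞} (hp : 0 < p) : CompactOn p (canonicalOp s t) := by
  obtain ⟨c, ε, hc, hε, hK⟩ := exists_weightedKernel_le hst hD
  obtain ⟨B, hB⟩ := exists_enorm_weighted_le hp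
  obtain ⟨c₀, hc₀, hnorm⟩ := exists_fockNorm_eq hp
  set I := ∫⁻ w : ℂ, ENNReal.ofReal (Real.exp (-ε * ‖w‖ ^ 2)) with hI
  have hIt : I ≠ ∞ := lintegral_exp_neg_mul_sq_norm_ne_top hε
  set G := eLpNorm (fun z : ℂ => Real.exp (-ε * ‖z‖ ^ 2)) p volume with hG
  have hGt : G ≠ ∞ := (memLp_exp_neg_mul_sq_norm hε hp).eLpNorm_ne_top
  have hJ : ∀ f ∈ Fock p, ∫⁻ w, ENNReal.ofReal (Real.exp (-ε * ‖w‖ ^ 2)) * ‖weighted f w‖ₑ ≤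
      I * (B * eLpNorm (weighted f) p volume) :=
    fun f hf => lintegral_exp_mul_le fun w => hB f hf.1 w
  have hJt : ∀ f ∈ Fock p,
      ∫⁻ w, ENNReal.ofReal (Real.exp (-ε * ‖w‖ ^ 2)) * ‖weighted f w‖ₑ ≠ ∞ := fun f hf =>
    ((hJ f hf).trans_lt (ENNReal.mul_lt_top hIt.lt_top
      (ENNReal.mul_lt_top ENNReal.coe_lt_top hf.2.2))).ne
  have hT := fun f hf => eLpNorm_canonicalOp_le_of_weightedKernel_le hc hK p (hJt f hf)
  set c₁ := ENNReal.ofReal (1 / Real.pi * c) with hc₁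
  have hc₁t : c₁ ≠ ∞ := ENNReal.ofReal_ne_top
  obtain ⟨L, hL, hLb⟩ := exists_isBoundedMap hst hp (C := (c₁ * I * B * G).toNNReal) (by
    intro f hf
    rw [ENNReal.coe_toNNReal (by finiteness)]
    calc _ ≤ c₁ * (∫⁻ w, ENNReal.ofReal (Real.exp (-ε * ‖w‖ ^ 2)) * ‖weighted f w‖ₑ) * G := hT f hf
      _ ≤ c₁ * (I * (B * eLpNorm (weighted f) p volume)) * G :=
        mul_le_mul_left (mul_le_mul_right (hJ f hf) _) _
      _ = _ := by ring)
  refine ⟨L, hL, hLb, fun f hf hfD => ?_⟩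
  obtain ⟨M, hM⟩ := hf
  set N : ℝ≥0∞ := B * (M / c₀) with hN
  have hc₀' : (c₀ : ℝ≥0∞) ≠ 0 := by simpa using hc₀
  have hNt : N ≠ ∞ :=
    ENNReal.mul_ne_top ENNReal.coe_ne_top (ENNReal.div_ne_top ENNReal.coe_ne_top hc₀')
  have hNb : ∀ n w, ‖weighted (f n) w‖ₑ ≤ N := by
    intro n w
    refine (hB _ (f n).2.1 w).trans (mul_le_mul_right ?_ _)
    rw [ENNReal.le_div_iff_mul_le (Or.inl hc₀') (Or.inl ENNReal.coe_ne_top), mul_comm,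
      ← hnorm _ (f n).2.1.continuous]
    exact hM n
  -- Dominated convergence: bounded point evaluations make the weighted functions uniformly bounded,
  -- and they tend to 0 pointwise.
  have hlim : Tendsto (fun n => ∫⁻ w, ENNReal.ofReal (Real.exp (-ε * ‖w‖ ^ 2)) *
      ‖weighted (f n) w‖ₑ) atTop (𝓝 (∫⁻ _ : ℂ, 0)) := by
    refine tendsto_lintegral_of_dominated_convergence
      (fun w => ENNReal.ofReal (Real.exp (-ε * ‖w‖ ^ 2)) * N) (fun n => ?_)
      (fun n => ae_of_all _ fun w => mul_le_mul_right (hNb n w) _) ?_ (ae_of_all _ fun w => ?_)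
    · have := (continuous_weighted (f n).2.1.continuous).measurable
      fun_prop
    · rw [lintegral_mul_const _ (by fun_prop)]
      exact ENNReal.mul_ne_top hIt hNt
    · have h1 : Tendsto (fun n => (f n : ℂ → ℂ) w) atTop (𝓝 0) :=
        (hfD {w} isCompact_singleton).tendsto_at (Set.mem_singleton w)
      have h2 : Tendsto (fun n => ‖weighted (f n) w‖ₑ) atTop (𝓝 0) := by
        have h3 := (h1.mul_const (Real.exp (-‖w‖ ^ 2 / 2) : ℂ)).enorm
        simpa [weighted] using h3
      simpa using ENNReal.Tendsto.const_mul h2 (Or.inr ENNReal.ofReal_ne_top)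
  rw [lintegral_zero] at hlim
  have hup : Tendsto (fun n => c₀ * (c₁ * (∫⁻ w, ENNReal.ofReal (Real.exp (-ε * ‖w‖ ^ 2)) *
      ‖weighted (f n) w‖ₑ) * G)) atTop (𝓝 0) := by
    have h1 := ENNReal.Tendsto.const_mul hlim (Or.inr hc₁t)
    have h2 := ENNReal.Tendsto.mul_const h1 (Or.inr hGt)
    have h3 := ENNReal.Tendsto.const_mul (a := (c₀ : ℝ≥0∞)) h2 (Or.inr ENNReal.coe_ne_top)
    simpa using h3
  refine tendsto_of_tendsto_of_tendsto_of_le_of_le tendsto_const_nhds hup (fun _ => zero_le)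
    fun n => ?_
  change fockNorm p (L (f n)) ≤ _
  rw [hnorm _ (L (f n)).2.1.continuous, hL]
  exact mul_le_mul_right (hT _ (f n).2) _

/-! ### The critical case -/

/-- Hölder's inequality for the measure k dA, whose total mass is ∫ k. -/
theorem lintegral_mul_rpow_le {k F : ℂ → ℝ≥0∞} (hk : Measurable k) (hF : Measurable F) {q : ℝ}
    (hq : 1 ≤ q) : (∫⁻ w, k w * F w) ^ q ≤ (∫⁻ w, k w) ^ (q - 1) * ∫⁻ w, k w * F w ^ q := by
  have hq0 : 0 < q := zero_lt_one.trans_le hq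
  set μ := (volume : Measure ℂ).withDensity k with hμ
  have h1 := eLpNorm_le_eLpNorm_mul_rpow_measure_univ (μ := μ) (f := F)
    (p := 1) (q := ENNReal.ofReal q) (by simpa using hq) hF.aestronglyMeasurable
  rw [eLpNorm_one_eq_lintegral_enorm, eLpNorm_eq_lintegral_rpow_enorm_toReal (by simpa using hq0)
    ENNReal.ofReal_ne_top, ENNReal.toReal_ofReal hq0.le] at h1
  simp only [enorm_eq_self] at h1
  rw [lintegral_withDensity_eq_lintegral_mul _ hk hF,
    lintegral_withDensity_eq_lintegral_mul _ hk (hF.pow_const q),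
    withDensity_apply _ MeasurableSet.univ, Measure.restrict_univ] at h1
  have h2 := ENNReal.rpow_le_rpow h1 hq0.le
  rw [ENNReal.mul_rpow_of_nonneg _ _ hq0.le, ← ENNReal.rpow_mul, ← ENNReal.rpow_mul,
    one_div_mul_cancel hq0.ne', ENNReal.rpow_one] at h2
  refine h2.trans (le_of_eq ?_)
  rw [mul_comm]
  congr 2
  simp
  field_simp

theorem continuous_peak (s t : ℂ) : Continuous (peak s t) := by
  unfold peak
  have := Complex.continuous_conj
  fun_prop

theorem lintegral_exp_sub_peak {s t : ℂ} (δ : ℝ) (z : ℂ) :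
    ∫⁻ w, ENNReal.ofReal (Real.exp (-δ * ‖w - peak s t z‖ ^ 2))
      = ∫⁻ w : ℂ, ENNReal.ofReal (Real.exp (-δ * ‖w‖ ^ 2)) :=
  lintegral_sub_right_eq_self (fun w : ℂ => ENNReal.ofReal (Real.exp (-δ * ‖w‖ ^ 2))) _

/-- The point w is itself the peak of b, so by linearity w - `peak s t z` is the peak of b - z and
has modulus at least (|s| - |t|)|z - b|. Comparison with a Gaussian centred at b replaces a change
of variables. -/
theorem lintegral_exp_sub_peak_left_le {s t : ℂ} (hst : ‖t‖ < ‖s‖)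
    (hD : ‖s‖ ^ 2 - ‖t‖ ^ 2 = 1) {δ : ℝ} (hδ : 0 < δ) (w : ℂ) :
    ∫⁻ z, ENNReal.ofReal (Real.exp (-δ * ‖w - peak s t z‖ ^ 2))
      ≤ ∫⁻ z : ℂ, ENNReal.ofReal (Real.exp (-(δ * (‖s‖ - ‖t‖) ^ 2) * ‖z‖ ^ 2)) := by
  set b := s * w + conj t * conj w with hb
  rw [← lintegral_sub_right_eq_self
    (fun z : ℂ => ENNReal.ofReal (Real.exp (-(δ * (‖s‖ - ‖t‖) ^ 2) * ‖z‖ ^ 2))) b]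
  refine lintegral_mono fun z => ENNReal.ofReal_le_ofReal (Real.exp_le_exp.2 ?_)
  have h1 : ‖w - peak s t z‖ = ‖peak s t (z - b)‖ := by
    rw [peak_sub, hb, peak_surjective hD, norm_sub_rev]
  rw [h1]
  have h2 := pow_le_pow_left₀ (mul_nonneg (sub_nonneg.2 hst.le) (norm_nonneg _))
    (le_norm_peak hD (z - b)) 2
  rw [mul_pow] at h2
  have h3 := mul_le_mul_of_nonneg_left h2 hδ.le
  linarith

/-- In the critical case `|T f|^q` is controlled by a Gaussian average of `|f|^q`. -/
theorem exists_enorm_rpow_le {s t : ℂ} (hst : ‖t‖ < ‖s‖) (hD : ‖s‖ ^ 2 - ‖t‖ ^ 2 = 1) {q : ℝ}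
    (hq : 0 < q) : ∃ C : ℝ≥0, ∃ δ : ℝ, 0 < δ ∧ ∀ f : ℂ → ℂ, Differentiable ℂ f → ∀ z,
      ‖weighted (canonicalOp s t f) z‖ₑ ^ q ≤
        C * ∫⁻ w, ENNReal.ofReal (Real.exp (-δ * ‖w - peak s t z‖ ^ 2)) * ‖weighted f w‖ₑ ^ q := by
  set δ := (1 - ‖t‖ / ‖s‖) / 2 with hδ
  have hδ0 : 0 < δ := ratio_pos hst
  set c := (Real.sqrt ‖s‖)⁻¹ with hc
  have hc0 : 0 ≤ c := by positivity
  have hK : ∀ z w, weightedKernel s t z w ≤ c * Real.exp (-δ * ‖w - peak s t z‖ ^ 2) := by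
    intro z w
    have := weightedKernel_le hst hD.ge z w
    rw [hD] at this
    simpa using this
  set c₁ := ENNReal.ofReal (1 / Real.pi) with hc₁
  have hc₁t : c₁ ≠ ∞ := ENNReal.ofReal_ne_top
  set c₂ := ENNReal.ofReal c with hc₂
  have hc₂t : c₂ ≠ ∞ := ENNReal.ofReal_ne_top
  rcases le_total q 1 with hq1 | hq1
  · obtain ⟨C, hC⟩ := exists_lintegral_rpow_le hq hq1 zero_le_one
    refine ⟨(c₁ ^ q * C * c₂ ^ q).toNNReal, q * δ, by positivity, fun f hf z => ?_⟩
    rw [ENNReal.coe_toNNReal (by finiteness)]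
    -- Conjugating the kernel leaves all moduli unchanged and makes the integrand entire in w. The
    -- exponent α = 1 collects the two half weights of f and of the kernel.
    set h : ℂ → ℂ := fun w => f w * conj (kernel s t z w) with hh
    set e := ENNReal.ofReal (Real.exp (-‖z‖ ^ 2 / 2)) with he
    have het : e ≠ ∞ := ENNReal.ofReal_ne_top
    have heq : ∀ w, ENNReal.ofReal (weightedKernel s t z w) * ‖weighted f w‖ₑ
        = e * ‖h w * (Real.exp (-1 * ‖w‖ ^ 2) : ℂ)‖ₑ := by
      intro w
      rw [← ofReal_norm, ← ofReal_norm, he, ← ENNReal.ofReal_mul (weightedKernel_nonneg _ _ _ _),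
        ← ENNReal.ofReal_mul (Real.exp_pos _).le, norm_weighted, hh, norm_mul, norm_mul,
        RCLike.norm_conj, Complex.norm_real, Real.norm_of_nonneg (Real.exp_pos _).le,
        weightedKernel, show -1 * ‖w‖ ^ 2 = -‖w‖ ^ 2 / 2 + -‖w‖ ^ 2 / 2 by ring, Real.exp_add]
      ring_nf
    calc ‖weighted (canonicalOp s t f) z‖ₑ ^ q
        ≤ (c₁ * ∫⁻ w, ENNReal.ofReal (weightedKernel s t z w) * ‖weighted f w‖ₑ) ^ q :=
          ENNReal.rpow_le_rpow (enorm_weighted_canonicalOp_le s t f z) hq.le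
      _ = c₁ ^ q * (e ^ q * (∫⁻ w, ‖h w * (Real.exp (-1 * ‖w‖ ^ 2) : ℂ)‖ₑ) ^ q) := by
          simp_rw [heq]
          rw [lintegral_const_mul' _ _ het, ENNReal.mul_rpow_of_nonneg _ _ hq.le,
            ENNReal.mul_rpow_of_nonneg _ _ hq.le]
      _ ≤ c₁ ^ q * (e ^ q * (C * ∫⁻ w, ‖h w * (Real.exp (-1 * ‖w‖ ^ 2) : ℂ)‖ₑ ^ q)) :=
          mul_le_mul_right (mul_le_mul_right
            (hC h (hf.mul (differentiable_conj_kernel s t z))) _) _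
      _ = c₁ ^ q * C * ∫⁻ w, (ENNReal.ofReal (weightedKernel s t z w) * ‖weighted f w‖ₑ) ^ q := by
          simp_rw [heq, ENNReal.mul_rpow_of_nonneg _ _ hq.le]
          rw [lintegral_const_mul' _ _ (by finiteness)]
          ring
      _ ≤ c₁ ^ q * C * ∫⁻ w, c₂ ^ q * (ENNReal.ofReal
            (Real.exp (-(q * δ) * ‖w - peak s t z‖ ^ 2)) * ‖weighted f w‖ₑ ^ q) := by
          refine mul_le_mul_right (lintegral_mono fun w => ?_) _
          rw [ENNReal.mul_rpow_of_nonneg _ _ hq.le, ← mul_assoc]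
          refine mul_le_mul_left ?_ _
          calc ENNReal.ofReal (weightedKernel s t z w) ^ q
              ≤ ENNReal.ofReal (c * Real.exp (-δ * ‖w - peak s t z‖ ^ 2)) ^ q :=
                ENNReal.rpow_le_rpow (ENNReal.ofReal_le_ofReal (hK z w)) hq.le
            _ = _ := by
                rw [ENNReal.ofReal_mul hc0, ENNReal.mul_rpow_of_nonneg _ _ hq.le,
                  ENNReal.ofReal_rpow_of_pos (Real.exp_pos _), ← Real.exp_mul, hc₂]
                ring_nf
      _ = _ := by
          rw [lintegral_const_mul' _ _ (by finiteness)]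
          ring
  · set I := ∫⁻ w : ℂ, ENNReal.ofReal (Real.exp (-δ * ‖w‖ ^ 2)) with hI
    have hIt : I ≠ ∞ := lintegral_exp_neg_mul_sq_norm_ne_top hδ0
    have hq1' : 0 ≤ q - 1 := by linarith
    refine ⟨((c₁ * c₂) ^ q * I ^ (q - 1)).toNNReal, δ, hδ0, fun f hf z => ?_⟩
    rw [ENNReal.coe_toNNReal (by finiteness)]
    have hfm := (continuous_weighted hf.continuous).measurable
    calc ‖weighted (canonicalOp s t f) z‖ₑ ^ q
        ≤ (c₁ * ∫⁻ w, ENNReal.ofReal (weightedKernel s t z w) * ‖weighted f w‖ₑ) ^ q :=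
          ENNReal.rpow_le_rpow (enorm_weighted_canonicalOp_le s t f z) hq.le
      _ ≤ (c₁ * ∫⁻ w, c₂ * (ENNReal.ofReal (Real.exp (-δ * ‖w - peak s t z‖ ^ 2)) *
            ‖weighted f w‖ₑ)) ^ q := by
          refine ENNReal.rpow_le_rpow (mul_le_mul_right (lintegral_mono fun w => ?_) _) hq.le
          rw [← mul_assoc, ← ENNReal.ofReal_mul hc0]
          exact mul_le_mul_left (ENNReal.ofReal_le_ofReal (hK z w)) _
      _ = (c₁ * c₂) ^ q * (∫⁻ w, ENNReal.ofReal (Real.exp (-δ * ‖w - peak s t z‖ ^ 2)) *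
            ‖weighted f w‖ₑ) ^ q := by
          rw [lintegral_const_mul' _ _ hc₂t, ← mul_assoc, ENNReal.mul_rpow_of_nonneg _ _ hq.le]
      _ ≤ (c₁ * c₂) ^ q * (I ^ (q - 1) * ∫⁻ w, ENNReal.ofReal
            (Real.exp (-δ * ‖w - peak s t z‖ ^ 2)) * ‖weighted f w‖ₑ ^ q) := by
          refine mul_le_mul_right ?_ _
          rw [hI, ← lintegral_exp_sub_peak (s := s) (t := t) δ z]
          exact lintegral_mul_rpow_le (by fun_prop) hfm.enorm hq1
      _ = _ := by ring

theorem exists_eLpNorm_le_of_eq_one {s t : ℂ} (hst : ‖t‖ < ‖s‖) (hD : ‖s‖ ^ 2 - ‖t‖ ^ 2 = 1)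
    {p : ℝ≥0∞} (hp : 0 < p) : ∃ C : ℝ≥0, ∀ f ∈ Fock p,
      eLpNorm (weighted (canonicalOp s t f)) p volume ≤ C * eLpNorm (weighted f) p volume := by
  by_cases hpt : p = ∞
  · subst hpt
    -- For p = ∞ the case q = 1 suffices: f is bounded by its norm and the remaining Gaussian
    -- integral does not depend on z.
    obtain ⟨C, δ, hδ, hC⟩ := exists_enorm_rpow_le hst hD one_pos
    set I := ∫⁻ w : ℂ, ENNReal.ofReal (Real.exp (-δ * ‖w‖ ^ 2)) with hI
    have hIt : I ≠ ∞ := lintegral_exp_neg_mul_sq_norm_ne_top hδ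
    refine ⟨C * I.toNNReal, fun f hf => ?_⟩
    rw [ENNReal.coe_mul, ENNReal.coe_toNNReal hIt, eLpNorm_exponent_top]
    refine essSup_le_of_ae_le _ (ae_of_all _ fun z => ?_)
    have h1 := hC f hf.1 z
    simp only [ENNReal.rpow_one] at h1
    refine h1.trans ?_
    rw [mul_assoc]
    refine mul_le_mul_right ?_ _
    rw [hI, ← lintegral_exp_sub_peak (s := s) (t := t) δ z, ← lintegral_mul_const' _ _
      hf.2.eLpNorm_ne_top]
    exact lintegral_mono fun w =>
      mul_le_mul_right (enorm_le_eLpNorm_top (continuous_weighted hf.1.continuous) w) _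
  · have hq : 0 < p.toReal := ENNReal.toReal_pos hp.ne' hpt
    set q := p.toReal with hqdef
    obtain ⟨C, δ, hδ, hC⟩ := exists_enorm_rpow_le hst hD hq
    have hm : 0 < δ * (‖s‖ - ‖t‖) ^ 2 := by
      have := sub_pos.2 hst
      positivity
    set I := ∫⁻ z : ℂ, ENNReal.ofReal (Real.exp (-(δ * (‖s‖ - ‖t‖) ^ 2) * ‖z‖ ^ 2)) with hI
    have hIt : I ≠ ∞ := lintegral_exp_neg_mul_sq_norm_ne_top hm
    refine ⟨((C * I) ^ (1 / q)).toNNReal, fun f hf => ?_⟩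
    rw [ENNReal.coe_toNNReal (by finiteness), eLpNorm_eq_lintegral_rpow_enorm_toReal hp.ne' hpt,
      eLpNorm_eq_lintegral_rpow_enorm_toReal hp.ne' hpt, ← hqdef,
      ← ENNReal.mul_rpow_of_nonneg _ _ (by positivity)]
    refine ENNReal.rpow_le_rpow ?_ (by positivity)
    have hfm := (continuous_weighted hf.1.continuous).measurable
    have hpm := (continuous_peak s t).measurable
    calc ∫⁻ z, ‖weighted (canonicalOp s t f) z‖ₑ ^ q
        ≤ ∫⁻ z, C * ∫⁻ w, ENNReal.ofReal (Real.exp (-δ * ‖w - peak s t z‖ ^ 2)) *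
          ‖weighted f w‖ₑ ^ q := lintegral_mono fun z => hC f hf.1 z
      -- Tonelli: the Gaussian average is now integrated in z first, which is bounded uniformly in
      -- w.
      _ = C * ∫⁻ w, ∫⁻ z, ENNReal.ofReal (Real.exp (-δ * ‖w - peak s t z‖ ^ 2)) *
          ‖weighted f w‖ₑ ^ q := by
          rw [lintegral_const_mul' _ _ ENNReal.coe_ne_top, lintegral_lintegral_swap]
          refine Measurable.aemeasurable ?_
          unfold Function.uncurry
          fun_prop
      _ ≤ C * ∫⁻ w, I * ‖weighted f w‖ₑ ^ q := by
          refine mul_le_mul_right (lintegral_mono fun w => ?_) _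
          rw [lintegral_mul_const' _ _ (by finiteness)]
          exact mul_le_mul_left (lintegral_exp_sub_peak_left_le hst hD hδ w) _
      _ = _ := by rw [lintegral_const_mul' _ _ hIt, mul_assoc]

/-! ### Necessity -/

theorem weightedKernel_peak {s t : ℂ} (hst : ‖t‖ < ‖s‖) (z : ℂ) :
    weightedKernel s t z (peak s t z) = (Real.sqrt ‖s‖)⁻¹ * Real.exp
      ((1 / (‖s‖ ^ 2 - ‖t‖ ^ 2) - 1) / 2 * (‖z‖ ^ 2 - (t * z ^ 2 / s).re)) := by
  rw [weightedKernel_eq hst]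
  congr 2
  simp

theorem one_le_of_boundedOn {s t : ℂ} (hst : ‖t‖ < ‖s‖) {p : ℝ≥0∞} (hp : 0 < p)
    (h : BoundedOn p (canonicalOp s t)) : 1 ≤ ‖s‖ ^ 2 - ‖t‖ ^ 2 := by
  obtain ⟨L, hL, hLb⟩ := h
  obtain ⟨C, hC⟩ := hLb.exists_eLpNorm_le hp
  obtain ⟨B, hB⟩ := exists_enorm_weighted_le hp
  have hs : 0 < ‖s‖ := (norm_nonneg t).trans_lt hst
  have hD0 : 0 < ‖s‖ ^ 2 - ‖t‖ ^ 2 := by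
    have := norm_nonneg t
    nlinarith
  set N : ℝ≥0∞ := B * (C * eLpNorm (fun w : ℂ => Real.exp (-(1 / 2) * ‖w‖ ^ 2)) p volume) with hN
  have hNt : N ≠ ∞ := ENNReal.mul_ne_top ENNReal.coe_ne_top (ENNReal.mul_ne_top ENNReal.coe_ne_top
    (memLp_exp_neg_mul_sq_norm (by norm_num) hp).eLpNorm_ne_top)
  -- The coherent states all have the same norm, so boundedness of the operator and of point
  -- evaluations bounds the weighted kernel everywhere.
  have hbd : ∀ z a, weightedKernel s t z a ≤ N.toReal := by
    intro z a
    set f : Fock p := ⟨coherent a, coherent_mem_fock hp a⟩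
    have h1 := (hB _ (L f).2.1 z).trans (mul_le_mul_right (hC f) _)
    rw [hL, eLpNorm_weighted_coherent] at h1
    have h2 := ENNReal.toReal_mono hNt h1
    rwa [toReal_enorm, norm_weighted_canonicalOp_coherent hst] at h2
  by_contra! hD
  set κ := (1 / (‖s‖ ^ 2 - ‖t‖ ^ 2) - 1) / 2 with hκ
  have hκ0 : 0 < κ := by
    have := (one_lt_div hD0).2 hD
    rw [hκ]
    linarith
  have hδ := ratio_pos hst
  set δ := (1 - ‖t‖ / ‖s‖) / 2 with hδdef
  set M := N.toReal * Real.sqrt ‖s‖ with hM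
  have hM0 : 0 ≤ M := by positivity
  -- Chosen so that κ · 2δ · r exceeds M. Since r ≥ 1, the exponent at z = r is at least κ · 2δ · r,
  -- and e^x ≥ 1 + x contradicts the bound M.
  set r := M / (κ * (2 * δ)) + 1 with hr
  have hr1 : 1 ≤ r := by
    have : 0 ≤ M / (κ * (2 * δ)) := by positivity
    linarith
  have h1 := hbd r (peak s t r)
  rw [weightedKernel_peak hst, inv_mul_le_iff₀ (Real.sqrt_pos.2 hs),
    mul_comm (Real.sqrt _), ← hM, ← hκ] at h1
  have h2 : κ * (2 * δ) * r ≤ κ * (‖(r : ℂ)‖ ^ 2 - (t * (r : ℂ) ^ 2 / s).re) := by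
    rw [mul_assoc]
    refine mul_le_mul_of_nonneg_left ?_ hκ0.le
    have h3 := (abs_le.1 (abs_re_quadratic_le s t r)).2
    have h4 : ‖(r : ℂ)‖ = r := by rw [Complex.norm_real, Real.norm_of_nonneg (by linarith)]
    rw [h4] at h3 ⊢
    have h5 : 2 * δ * r ≤ 2 * δ * r ^ 2 := by
      gcongr
      nlinarith
    have h6 : 2 * δ * r ^ 2 = r ^ 2 - ‖t‖ / ‖s‖ * r ^ 2 := by
      rw [hδdef]; ring
    linarith
  have h7 : κ * (2 * δ) * r = M + κ * (2 * δ) := by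
    rw [hr]
    field_simp
  have h8 := Real.add_one_le_exp (κ * (‖(r : ℂ)‖ ^ 2 - (t * (r : ℂ) ^ 2 / s).re))
  have h9 : 0 < κ * (2 * δ) := by positivity
  linarith

theorem tendstoUniformlyOn_coherent {a : ℕ → ℂ} (ha : Tendsto (fun n => ‖a n‖) atTop atTop)
    {D : Set ℂ} (hD : IsCompact D) :
    TendstoUniformlyOn (fun n => coherent (a n)) (fun _ => (0 : ℂ)) atTop D := by
  obtain ⟨R, hR⟩ := hD.isBounded.exists_norm_le
  -- On |w| ≤ R the modulus of the coherent state at a is at most exp(|a|(R - |a|/2)).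
  have hlim : Tendsto (fun x : ℝ => Real.exp (x * (R - x / 2))) atTop (𝓝 0) := by
    refine Real.tendsto_exp_atBot.comp (tendsto_id.atTop_mul_atBot₀ ?_)
    refine tendsto_atBot_add_const_left _ R ?_
    exact tendsto_neg_atTop_atBot.comp (tendsto_id.atTop_div_const two_pos)
  rw [Metric.tendstoUniformlyOn_iff]
  intro ε hε
  filter_upwards [(hlim.comp ha).eventually (gt_mem_nhds hε)] with n hn w hw
  rw [dist_zero_left]
  refine lt_of_le_of_lt ?_ hn
  rw [coherent, Complex.norm_exp]
  refine Real.exp_le_exp.2 ?_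
  rw [Complex.sub_re, Complex.ofReal_re]
  have h1 : (conj (a n) * w).re ≤ ‖a n‖ * R := by
    refine (Complex.re_le_norm _).trans ?_
    rw [norm_mul, RCLike.norm_conj]
    exact mul_le_mul_of_nonneg_left (hR w hw) (norm_nonneg _)
  have h2 : ‖a n‖ * (R - ‖a n‖ / 2) = ‖a n‖ * R - ‖a n‖ ^ 2 / 2 := by ring
  rw [h2]
  linarith

theorem not_compactOn_of_eq_one {s t : ℂ} (hst : ‖t‖ < ‖s‖) (hD : ‖s‖ ^ 2 - ‖t‖ ^ 2 = 1)
    {p : ℝ≥0∞} (hp : 0 < p) : ¬ CompactOn p (canonicalOp s t) := by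
  rintro ⟨L, hL, -, hLc⟩
  obtain ⟨B, hB⟩ := exists_enorm_weighted_le hp
  obtain ⟨c, hc0, hc⟩ := exists_fockNorm_eq hp
  have hs : 0 < ‖s‖ := (norm_nonneg t).trans_lt hst
  -- With a n the peak of z = n, the weighted modulus of the n-th image at n is exactly |s|^{-1/2},
  -- so the images stay bounded below in norm.
  set a : ℕ → ℂ := fun n => peak s t n with ha
  have hat : Tendsto (fun n => ‖a n‖) atTop atTop := by
    refine tendsto_atTop_mono (fun n => le_norm_peak hD n) ?_
    simp only [Complex.norm_natCast]
    exact tendsto_natCast_atTop_atTop.const_mul_atTop (sub_pos.2 hst)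
  set f : ℕ → Fock p := fun n => ⟨coherent (a n), coherent_mem_fock hp (a n)⟩ with hf
  have hlim := hLc f ?_ fun D hDc => tendstoUniformlyOn_coherent hat hDc
  · have hlow : ∀ n, ENNReal.ofReal ((Real.sqrt ‖s‖)⁻¹) * c ≤ B * fockNorm p (L (f n)) := by
      intro n
      have h1 := hB _ (L (f n)).2.1 n
      rw [hc _ (L (f n)).2.1.continuous, mul_left_comm, mul_comm _ (c : ℝ≥0∞)]
      refine mul_le_mul_right (le_trans (le_of_eq ?_) h1) _
      rw [hL, ← ofReal_norm, norm_weighted_canonicalOp_coherent hst, ha, weightedKernel_peak hst,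
        hD]
      simp
    have h2 := ENNReal.Tendsto.const_mul (a := (B : ℝ≥0∞)) hlim (Or.inr ENNReal.coe_ne_top)
    have h3 := ge_of_tendsto' h2 hlow
    rw [mul_zero, nonpos_iff_eq_zero, mul_eq_zero, ENNReal.ofReal_eq_zero] at h3
    rcases h3 with h3 | h3
    · have : 0 < (Real.sqrt ‖s‖)⁻¹ := by positivity
      linarith
    · exact hc0 (by simpa using h3)
  · refine ⟨c * (eLpNorm (fun w : ℂ => Real.exp (-(1 / 2) * ‖w‖ ^ 2)) p volume).toNNReal,
      fun n => ?_⟩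
    rw [hc _ (f n).2.1.continuous, ENNReal.coe_mul, ENNReal.coe_toNNReal
      (memLp_exp_neg_mul_sq_norm (by norm_num) hp).eLpNorm_ne_top, eLpNorm_weighted_coherent]

end FockSpace

/-! ### The boundedness and compactness criteria -/

theorem theoremB (s t : ℂ) (hst : ‖t‖ < ‖s‖) :
    (∀ f ∈ FockSpace.Fock ∞,
      (∀ z : ℂ, Integrable (fun w => FockSpace.kernel s t z w * f w) FockSpace.gaussian) ∧
      Differentiable ℂ (FockSpace.canonicalOp s t f)) ∧
    ∀ p : ℝ≥0∞, 0 < p →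
      (FockSpace.BoundedOn p (FockSpace.canonicalOp s t) ↔ ‖t‖ ^ 2 + 1 ≤ ‖s‖ ^ 2) ∧
      (FockSpace.CompactOn p (FockSpace.canonicalOp s t) ↔ ‖t‖ ^ 2 + 1 < ‖s‖ ^ 2) := by
  refine ⟨fun f hf => ⟨fun z => FockSpace.integrable_gaussian_iff.2
    (FockSpace.integrable_kernel_mul hst hf z), FockSpace.differentiable_canonicalOp hst hf⟩,
    fun p hp => ?_⟩
  have hcompact : ‖t‖ ^ 2 + 1 < ‖s‖ ^ 2 → FockSpace.CompactOn p (FockSpace.canonicalOp s t) :=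
    fun h => FockSpace.compactOn_of_one_lt hst (by linarith) hp
  have hnec : FockSpace.BoundedOn p (FockSpace.canonicalOp s t) → ‖t‖ ^ 2 + 1 ≤ ‖s‖ ^ 2 :=
    fun h => by
      have := FockSpace.one_le_of_boundedOn hst hp h
      linarith
  have hbdd : FockSpace.CompactOn p (FockSpace.canonicalOp s t) →
      FockSpace.BoundedOn p (FockSpace.canonicalOp s t) :=
    fun ⟨L, hL, hLb, _⟩ => ⟨L, hL, hLb⟩
  refine ⟨⟨hnec, fun h => ?_⟩, fun h => ?_, hcompact⟩
  · rcases h.lt_or_eq with h | h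
    · exact hbdd (hcompact h)
    · obtain ⟨C, hC⟩ := FockSpace.exists_eLpNorm_le_of_eq_one hst (by linarith) hp
      exact FockSpace.exists_isBoundedMap hst hp hC
  · refine lt_of_le_of_ne (hnec (hbdd h)) fun heq => ?_
    exact FockSpace.not_compactOn_of_eq_one hst (by linarith) hp h
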